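/- **Setting.** A token is a quintuple $(q,k_1,k_2,v_1,v_2)$ of vectors in $\mathbb R^d$. For a stream of $n$ tokens let $K_1,K_2,V_1,V_2\in\mathbb R^{n\times d}$ be the matrices whose rows are the keys and values, let $A\oslash B\in\mathbb R^{n^2\times d}$ be the matrix whose rows are the entrywise products of a row of $A$ and a row of $B$, and put $$w=\mathrm{softmax}\big((K_1\oslash K_2)\,q_n\big),\qquad \mathsf{Attn}_n=(V_1\oslash V_2)^\top w\in\mathbb R^d .$$ A streaming algorithm with $S$ bits of memory has memory states in $\{0,1\}^S$. Its initial state may be random. On each arriving token it draws its new state and an output in $\mathbb R^d$, with a law that depends only on the old state and on that token. Let $d=d(n)$ satisfy $2\le d$ and $d=o(\log n)$, and let $b=b(n)=\Theta(\log n)$. A stream of length $n$ is *admissible* if all keys satisfy $\|k_{1,i}\|_2\le1$, $\|k_{2,i}\|_2\le 1$, and all coordinates of keys and values are integer multiples of $2^{-b}$ of absolute value at most $2^{b}$ (numbers of $O(\log n)$ bits). The queries are arbitrary vectors in $\mathbb R^d$. **Theorem (optimality of SubGen4Cache).** 1. *Space upper bound.* Let $r=r(n)=O(\log\log n)$. There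 are constants $C,K$ (independent of $n$ and $\varepsilon$) such that for all sufficiently large $n$ and every $\varepsilon\in(0,1)$ there is a streaming algorithm with at most $C\,\varepsilon^{-2}\,d\,e^{d}\,(\log n)^K$ bits of memory, i.e. $\widetilde O(d e^d)$ bits, whose output $\widehat O_n$ after $n$ tokens satisfies, on every admissible stream with $\|q_i\|_2\le r$ for all $i\le n$, $$\Pr\Big[\ \|\widehat O_n-\mathsf{Attn}_n\|_2\le\varepsilon\,\|w\|_2\,\|V_1\oslash V_2\|_2\ \Big]\ge 0.99 ,$$ where the norm of the matrix is the spectral norm. 2. *Clusterability.* For every $d\ge2$, any finite sequence of points of norm at most $1$ in $\mathbb R^d$ (in particular the keys) can be partitioned into $\lceil e^d\rceil$ (possibly empty) clusters, each contained in a closed ball of radius $e/3$. 3. *Space lower bound.* There is an absolute constant $c>0$ such that, for all $d$ and $b$ as above, for all sufficiently large $n$ and for every $\eta\in(0,1)$: every streaming algorithm which on every admissible stream (with arbitrary queries) outputs after $n$ tokens, with probability at least $9/10$, a vector $O$ with $|O_j-(\mathsf{Attn}_n)_j|\le\eta\,|(\mathsf{Attn}_n)_j|$ for all coordinates $j$,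 uses at least $c\,d\,e^d$ bits of memory. -/

import Mathlib

open Filter Asymptotics
open scoped ENNReal Topology

/-! ### Tensor attention -/

/-- The softmax of a real vector with an arbitrary finite index set. -/
noncomputable def softmax {ι : Type*} [Fintype ι] (z : ι → ℝ) : ι → ℝ :=
  fun j => Real.exp (z j) / ∑ k, Real.exp (z k)

/-- The column-wise Kronecker product of `A` and `B`. Its rows are indexed by pairs of rows
(instead of a flattened index); row `(a, b)` is the entrywise product of row `a` of `A` and
row `b` of `B`. -/
def colKron {ι κ : Type*} {d : ℕ} (A : Matrix ι (Fin d) ℝ) (B : Matrix κ (Fin d) ℝ) :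
    Matrix (ι × κ) (Fin d) ℝ :=
  Matrix.of fun p j => A p.1 j * B p.2 j

/-- Tensor attention `(V₁ ⊘ V₂)ᵀ · softmax ((K₁ ⊘ K₂) · q)`. -/
noncomputable def tensorAttn {n d : ℕ} (q : Fin d → ℝ) (K₁ K₂ V₁ V₂ : Matrix (Fin n) (Fin d) ℝ) :
    Fin d → ℝ :=
  (colKron V₁ V₂).transpose.mulVec (softmax ((colKron K₁ K₂).mulVec q))

/-- The Euclidean norm of a vector. -/
noncomputable def vecNorm₂ {ι : Type*} [Fintype ι] (v : ι → ℝ) : ℝ :=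
  ‖(WithLp.toLp 2 v : EuclideanSpace ℝ ι)‖

/-- The spectral norm of a matrix: its operator norm between Euclidean spaces. -/
noncomputable def matNorm₂ {ι : Type*} [Fintype ι] {d : ℕ} (M : Matrix ι (Fin d) ℝ) : ℝ :=
  ‖LinearMap.toContinuousLinearMap (Matrix.toLpLin 2 2 M)‖

/-! ### Streams of tokens -/

/-- One element of the input stream: a query, two keys and two values. -/
structure Token (d : ℕ) where
  q : EuclideanSpace ℝ (Fin d)
  k₁ : EuclideanSpace ℝ (Fin d)
  k₂ : EuclideanSpace ℝ (Fin d)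
  v₁ : EuclideanSpace ℝ (Fin d)
  v₂ : EuclideanSpace ℝ (Fin d)

namespace Token

variable {d : ℕ}

/-- The first key matrix after `n` tokens (token `i` is `x (i - 1)`). -/
def K₁ (x : ℕ → Token d) (n : ℕ) : Matrix (Fin n) (Fin d) ℝ := Matrix.of fun i j => (x i).k₁ j

/-- The second key matrix after `n` tokens. -/
def K₂ (x : ℕ → Token d) (n : ℕ) : Matrix (Fin n) (Fin d) ℝ := Matrix.of fun i j => (x i).k₂ j

/-- The first value matrix after `n` tokens. -/
def V₁ (x : ℕ → Token d) (n : ℕ) : Matrix (Fin n) (Fin d) ℝ := Matrix.of fun i j => (x i).v₁ j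

/-- The second value matrix after `n` tokens. -/
def V₂ (x : ℕ → Token d) (n : ℕ) : Matrix (Fin n) (Fin d) ℝ := Matrix.of fun i j => (x i).v₂ j

/-- The query of the `n`-th token, for `n ≥ 1`. -/
def query (x : ℕ → Token d) (n : ℕ) : Fin d → ℝ := fun j => (x (n - 1)).q j

/-- The softmax weights of the `n`-th query over all `n²` pairs of keys. -/
noncomputable def weights (x : ℕ → Token d) (n : ℕ) : Fin n × Fin n → ℝ :=
  softmax ((colKron (K₁ x n) (K₂ x n)).mulVec (query x n))

/-- The exact attention output of the `n`-th query against all `n` tokens seen so far. -/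
noncomputable def attn (x : ℕ → Token d) (n : ℕ) : Fin d → ℝ :=
  tensorAttn (query x n) (K₁ x n) (K₂ x n) (V₁ x n) (V₂ x n)

end Token

/-- `y` is a fixed-point number with `b` binary places and absolute value at most `2 ^ b`. -/
def IsFixedPoint (b : ℕ) (y : ℝ) : Prop :=
  |y| ≤ 2 ^ b ∧ ∃ z : ℤ, y = (z : ℝ) / 2 ^ b

/-- The first `n` tokens of the stream have keys of Euclidean norm at most one, and their key and
value coordinates are fixed-point numbers with `b` binary places. Queries are unrestricted. -/
def IsAdmissible {d : ℕ} (b n : ℕ) (x : ℕ → Token d) : Prop :=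
  ∀ i < n, ‖(x i).k₁‖ ≤ 1 ∧ ‖(x i).k₂‖ ≤ 1 ∧
    ∀ j, IsFixedPoint b ((x i).k₁ j) ∧ IsFixedPoint b ((x i).k₂ j) ∧
      IsFixedPoint b ((x i).v₁ j) ∧ IsFixedPoint b ((x i).v₂ j)

/-! ### Randomized streaming algorithms with `S` bits of memory -/

/-- A randomized one-pass streaming algorithm whose memory consists of `S` bits. When an input
arrives (the initial memory may be random), it draws its new memory content and an output, with a law determined by the old memory
content and that input only: there is no free clock and no free storage for random bits. -/
structure StreamingAlgorithm (S : ℕ) (I O : Type*) where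
  init : PMF (Fin S → Bool)
  step : (Fin S → Bool) → I → PMF ((Fin S → Bool) × O)

namespace StreamingAlgorithm

variable {S : ℕ} {I O : Type*}

/-- The law of the memory content after the first `t` inputs `x 0, …, x (t - 1)`. -/
noncomputable def memoryLaw (A : StreamingAlgorithm S I O) (x : ℕ → I) :
    ℕ → PMF (Fin S → Bool)
  | 0 => A.init
  | t + 1 => (memoryLaw A x t).bind fun s => (A.step s (x t)).map Prod.fst

/-- The law of the output produced on arrival of the `n`-th input `x (n - 1)`, for `n ≥ 1`. -/
noncomputable def outputLaw (A : StreamingAlgorithm S I O) (x : ℕ → I) (n : ℕ) : PMF O :=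
  (A.memoryLaw x (n - 1)).bind fun s => (A.step s (x (n - 1))).map Prod.snd

/-- The probability that the `n`-th output on the stream `x` lies in `E`. -/
noncomputable def outputProb (A : StreamingAlgorithm S I O) (x : ℕ → I) (n : ℕ) (E : Set O) :
    ℝ≥0∞ :=
  (A.outputLaw x n).toOuterMeasure E

end StreamingAlgorithm

/-- A streaming algorithm for tensor attention in dimension `d` with `S` bits of memory. -/
abbrev AttnAlgorithm (S d : ℕ) := StreamingAlgorithm S (Token d) (Fin d → ℝ)

/-- The outputs whose Euclidean error is at most `ε` times the Euclidean norm of the softmax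
weights times the spectral norm of `V₁ ⊘ V₂`, after `n` tokens. -/
def additiveApprox {d : ℕ} (x : ℕ → Token d) (n : ℕ) (ε : ℝ) : Set (Fin d → ℝ) :=
  {o | vecNorm₂ (o - Token.attn x n) ≤
    ε * vecNorm₂ (Token.weights x n) * matNorm₂ (colKron (Token.V₁ x n) (Token.V₂ x n))}

/-- The outputs that are an (entrywise) `(1 ± η)`-approximation of the attention output. -/
def relativeApprox {d : ℕ} (x : ℕ → Token d) (n : ℕ) (η : ℝ) : Set (Fin d → ℝ) :=
  {o | ∀ j, |o j - Token.attn x n j| ≤ η * |Token.attn x n j|}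

/-! ### Clusterability -/

/-- The points can be partitioned into `m` (possibly empty) clusters, each of which is contained
in a closed Euclidean ball of radius `δ`. -/
def IsBallClusterable {n d : ℕ} (m : ℕ) (δ : ℝ) (x : Fin n → EuclideanSpace ℝ (Fin d)) : Prop :=
  ∃ (c : Fin n → Fin m) (p : Fin m → EuclideanSpace ℝ (Fin d)), ∀ i, ‖x i - p (c i)‖ ≤ δ

/-! ### The asymptotic regime -/

/-- The low-dimensional regime: `2 ≤ d = o(log n)`, and numbers have `Θ(log n)` bits. -/
structure IsLowDim (d b : ℕ → ℕ) : Prop where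
  two_le : ∀ n, 2 ≤ d n
  dim : (fun n : ℕ => (d n : ℝ)) =o[atTop] fun n : ℕ => Real.log n
  bits : (fun n : ℕ => (b n : ℝ)) =Θ[atTop] fun n : ℕ => Real.log n

/-! The three claims are proved independently; in particular the upper bound does not use the
clustering.

Clusterability. For d ≥ 3, take a maximal set of directions with pairwise inner products below β = 1
- 2r². Every nonzero point then makes a small angle with some chosen direction v and is close to βv.
To count the directions, the balls of radius r around them are disjoint; cutting each by its tangent
hyperplane keeps half the volume and puts the pieces in a ball of radius √(1 + r²) instead of 1 + r
(`card_mul_pow_le_of_inner_lt`). That gain brings the base of the exponential below e. For d = 2 the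
four points (±1/2, ±1/2) serve as centres.

Lower bound. Reduction from the index problem with ⌈e^d⌉ · d bits. Keys lie on a parabola, so an
unbounded query can peak sharply at any chosen row, and the signs of the output reveal the bits of
that row (`codeStream_attn_sign`). A relative error below 1 preserves signs. Since the memory is
fixed before the query arrives, some state must predict 9/10 of all bits on average; an
exponential-moment count shows that one state does so for few bit vectors
(`two_pow_card_le_of_predictors`).

Upper bound. Draw T uniform pairs of positions in advance, store the corresponding keys and values
exactly, and output the self-normalized average. Scores are bounded by r, so the mean squared error
is at most e^{4r}/T times the mean squared row norm of V₁ ⊘ V₂. The squared Frobenius norm is at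
most d times the squared spectral norm, and 1/n² ≤ ‖w‖², so T of order e^{4r} d/ε² suffices by
Chebyshev (`card_bad_samples_le`); e^{4r} is polylogarithmic because r = O(log log n). -/

/-! ### Covering the unit ball by few balls of radius e/3 -/

open MeasureTheory in
/-- A closed half-ball cut off by a hyperplane through the centre has at least half the volume. -/
theorem volume_ball_le_two_mul_halfBall {d : ℕ} (u : EuclideanSpace ℝ (Fin d)) (hu : ‖u‖ = 1)
    (r : ℝ) :
    volume (Metric.ball u r) ≤ 2 * volume (Metric.ball u r ∩ {y | inner ℝ y u ≤ 1}) := by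
  set A := Metric.ball u r ∩ {y | inner ℝ y u ≤ (1 : ℝ)} with hA
  have hmeas : MeasurableSet A := by
    refine Metric.isOpen_ball.measurableSet.inter (IsClosed.measurableSet ?_)
    exact isClosed_le (by fun_prop) continuous_const
  -- The point reflection through u preserves volume and the ball, and maps the discarded half into
  -- A.
  have hpre : volume ((fun y => (u + u) - y) ⁻¹' A) = volume A :=
    (Measure.measurePreserving_sub_left volume (u + u)).measure_preimage hmeas.nullMeasurableSet
  have hsub : Metric.ball u r ⊆ A ∪ (fun y => (u + u) - y) ⁻¹' A := by
    intro y hy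
    by_cases h : inner ℝ y u ≤ (1 : ℝ)
    · exact Or.inl ⟨hy, h⟩
    · refine Or.inr ⟨?_, ?_⟩
      · rw [Metric.mem_ball, dist_eq_norm] at hy ⊢
        rwa [show u + u - y - u = -(y - u) by abel, norm_neg]
      · have h1 : inner ℝ u u = (1 : ℝ) := by rw [real_inner_self_eq_norm_sq, hu]; norm_num
        simp only [Set.mem_ofPred_eq, inner_sub_left, inner_add_left, h1]
        linarith
  calc volume (Metric.ball u r) ≤ volume A + volume ((fun y => (u + u) - y) ⁻¹' A) :=
        (measure_mono hsub).trans (measure_union_le _ _)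
    _ = 2 * volume A := by rw [hpre, two_mul]

open MeasureTheory in
/-- The number of unit vectors with pairwise inner products below `1 - 2 r ^ 2` is at most
`2 * (√(1 + r²) / r) ^ d`. -/
theorem card_mul_pow_le_of_inner_lt {d : ℕ} {r : ℝ} (hr : 0 < r)
    (s : Finset (EuclideanSpace ℝ (Fin d))) (hs : ∀ u ∈ s, ‖u‖ = 1)
    (hsep : ∀ u ∈ s, ∀ v ∈ s, u ≠ v → inner ℝ u v < 1 - 2 * r ^ 2) :
    (s.card : ℝ) * r ^ d ≤ 2 * √(1 + r ^ 2) ^ d := by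
  set H : EuclideanSpace ℝ (Fin d) → Set (EuclideanSpace ℝ (Fin d)) :=
    fun u => Metric.ball u r ∩ {y | inner ℝ y u ≤ (1 : ℝ)} with hH
  have hmeas : ∀ u ∈ s, MeasurableSet (H u) := fun u _ =>
    Metric.isOpen_ball.measurableSet.inter
      (isClosed_le (by fun_prop) continuous_const).measurableSet
  have hdisj : Set.PairwiseDisjoint (s : Set (EuclideanSpace ℝ (Fin d))) H := by
    intro u hu v hv huv
    refine Disjoint.mono Set.inter_subset_left Set.inter_subset_left ?_
    apply Metric.ball_disjoint_ball
    have h := norm_sub_sq_real u v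
    rw [hs u hu, hs v hv] at h
    have h2 := hsep u hu v hv huv
    rw [dist_eq_norm]
    by_contra! hlt
    nlinarith [norm_nonneg (u - v)]
  -- On the cut ball, ‖y‖² = ‖y - u‖² + 2⟨y, u⟩ - 1 ≤ r² + 1.
  have hsub : (⋃ u ∈ s, H u) ⊆ Metric.closedBall 0 (√(1 + r ^ 2)) := by
    intro y hy
    simp only [Set.mem_iUnion, exists_prop] at hy
    obtain ⟨u, hu, hy1, hy2⟩ := hy
    rw [mem_closedBall_zero_iff]
    apply Real.le_sqrt_of_sq_le
    rw [Metric.mem_ball, dist_eq_norm] at hy1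
    have h := norm_sub_sq_real y u
    rw [hs u hu] at h
    simp only [Set.mem_ofPred_eq] at hy2
    nlinarith [norm_nonneg (y - u)]
  set B := volume (Metric.ball (0 : EuclideanSpace ℝ (Fin d)) 1) with hB
  have hB0 : B ≠ 0 := (Metric.measure_ball_pos volume _ one_pos).ne'
  have hBt : B ≠ ⊤ := measure_ball_lt_top.ne
  have key : (s.card : ℝ≥0∞) * (ENNReal.ofReal (r ^ d) * B) ≤
      2 * (ENNReal.ofReal (√(1 + r ^ 2) ^ d) * B) := by
    have hfin : Module.finrank ℝ (EuclideanSpace ℝ (Fin d)) = d := by simp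
    calc (s.card : ℝ≥0∞) * (ENNReal.ofReal (r ^ d) * B)
        = ∑ u ∈ s, volume (Metric.ball u r) := by
          rw [← nsmul_eq_mul, ← Finset.sum_const]
          refine Finset.sum_congr rfl fun u _ => ?_
          rw [Measure.addHaar_ball_of_pos volume u hr, hfin]
      _ ≤ ∑ u ∈ s, 2 * volume (H u) :=
          Finset.sum_le_sum fun u hu => volume_ball_le_two_mul_halfBall u (hs u hu) r
      _ = 2 * volume (⋃ u ∈ s, H u) := by
          rw [← Finset.mul_sum, measure_biUnion_finset hdisj hmeas]
      _ ≤ 2 * volume (Metric.closedBall (0 : EuclideanSpace ℝ (Fin d)) (√(1 + r ^ 2))) := by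
          gcongr
      _ = 2 * (ENNReal.ofReal (√(1 + r ^ 2) ^ d) * B) := by
          rw [Measure.addHaar_closedBall volume _ (Real.sqrt_nonneg _), hfin]
  rw [← mul_assoc, ← mul_assoc, ENNReal.mul_le_mul_iff_left hB0 hBt,
    show (s.card : ℝ≥0∞) = ENNReal.ofReal s.card by simp,
    show (2 : ℝ≥0∞) = ENNReal.ofReal 2 by simp, ← ENNReal.ofReal_mul (by positivity),
    ← ENNReal.ofReal_mul (by positivity), ENNReal.ofReal_le_ofReal_iff (by positivity)] at key
  exact key

/-- A maximal subset of unit vectors with pairwise inner products below `β`. -/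
theorem exists_maximal_inner_lt {d : ℕ} {β : ℝ} (hβ : β ≤ 1)
    (U : Finset (EuclideanSpace ℝ (Fin d))) (hU : ∀ u ∈ U, ‖u‖ = 1) :
    ∃ s ⊆ U, (∀ u ∈ s, ∀ v ∈ s, u ≠ v → inner ℝ u v < β) ∧
      ∀ u ∈ U, ∃ v ∈ s, β ≤ inner ℝ u v := by
  classical
  obtain ⟨s, hs, hmax⟩ := Finset.exists_max_image
    (U.powerset.filter fun s => ∀ u ∈ s, ∀ v ∈ s, u ≠ v → inner ℝ u v < β) Finset.card
    ⟨∅, by simp⟩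
  simp only [Finset.mem_filter, Finset.mem_powerset] at hs hmax
  refine ⟨s, hs.1, hs.2, fun u hu => ?_⟩
  by_contra! hcon
  have hus : u ∉ s := fun h => by
    have := hcon u h
    rw [real_inner_self_eq_norm_sq, hU u hu] at this
    linarith
  have := hmax (insert u s) ⟨Finset.insert_subset hu hs.1, ?_⟩
  · rw [Finset.card_insert_of_notMem hus] at this
    omega
  · intro a ha b hb hab
    rcases Finset.mem_insert.1 ha with ha' | ha' <;>
      rcases Finset.mem_insert.1 hb with hb' | hb'
    · exact absurd (ha'.trans hb'.symm) hab
    · rw [ha']; exact hcon b hb'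
    · rw [hb', real_inner_comm]; exact hcon a ha'
    · exact hs.2 a ha' b hb' hab

/-- A finite set of at most `m ≥ 1` centres yields a clustering into `m` clusters. -/
theorem IsBallClusterable.of_finset {n d m : ℕ} {δ : ℝ} {x : Fin n → EuclideanSpace ℝ (Fin d)}
    (P : Finset (EuclideanSpace ℝ (Fin d))) (hP : P.card ≤ m)
    (h : ∀ i, ∃ p ∈ P, ‖x i - p‖ ≤ δ) : IsBallClusterable m δ x := by
  choose p hp hd using h
  let e := P.equivFin
  refine ⟨fun i => Fin.castLE hP (e ⟨p i, hp i⟩),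
    fun k => if hk : (k : ℕ) < P.card then (e.symm ⟨k, hk⟩ : EuclideanSpace ℝ (Fin d)) else 0,
    fun i => ?_⟩
  simp only [Fin.val_castLE, Fin.is_lt, dite_true, Fin.eta, Equiv.symm_apply_apply]
  exact hd i

/-- A point of the unit ball making a small angle with the unit vector `u` is close to `β u`. -/
theorem norm_sub_smul_sq_le {d : ℕ} {β : ℝ} (hβ0 : 0 ≤ β) (hβ : 2 * β ^ 2 ≤ 1)
    {x u : EuclideanSpace ℝ (Fin d)} (hx : ‖x‖ ≤ 1) (hu : ‖u‖ = 1)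
    (h : β * ‖x‖ ≤ inner ℝ x u) : ‖x - β • u‖ ^ 2 ≤ 1 - β ^ 2 := by
  rw [norm_sub_sq_real, real_inner_smul_right, norm_smul, hu, Real.norm_eq_abs, mul_one, sq_abs]
  have h1 := mul_le_mul_of_nonneg_left h hβ0
  -- With t = ‖x‖, t² ≤ t gives t² - 2β²t + β² ≤ (1 - 2β²)t + β², which is largest at t = 1.
  nlinarith [norm_nonneg x, mul_nonneg (norm_nonneg x) (sub_nonneg.2 hx)]

theorem exp_one_div_three_sq : (0.820997 : ℝ) < (Real.exp 1 / 3) ^ 2 := by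
  have := Real.exp_one_gt_d9
  nlinarith


/-- With r² = 0.288 the ratio √(1 + r²)/r is below e/1.26, and 1.26³ just exceeds 2, absorbing the
factor lost to half-balls. This is why d ≥ 3 is needed. -/
theorem two_mul_sqrt_pow_le {d : ℕ} (hd : 3 ≤ d) :
    2 * √(1 + 0.288) ^ d ≤ Real.exp d * √0.288 ^ d := by
  have he : Real.exp d = Real.exp 1 ^ d := by rw [← Real.exp_nat_mul]; simp
  have hq : 1.26 * √(1 + 0.288) ≤ Real.exp 1 * √0.288 := by
    refine le_of_sq_le_sq ?_ (by positivity)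
    rw [mul_pow, mul_pow, Real.sq_sqrt (by norm_num), Real.sq_sqrt (by norm_num)]
    have := Real.exp_one_gt_d9
    nlinarith
  calc 2 * √(1 + 0.288) ^ d ≤ 1.26 ^ d * √(1 + 0.288) ^ d := by
        gcongr
        calc (2 : ℝ) ≤ 1.26 ^ 3 := by norm_num
          _ ≤ 1.26 ^ d := pow_le_pow_right₀ (by norm_num) hd
    _ = (1.26 * √(1 + 0.288)) ^ d := by rw [mul_pow]
    _ ≤ (Real.exp 1 * √0.288) ^ d := by gcongr
    _ = Real.exp d * √0.288 ^ d := by rw [mul_pow, he]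

/-- The value β = 0.424 = 1 - 2 · 0.288 lies just above √(1 - e²/9), the threshold at which the
distance bound 1 - β² drops below (e/3)². -/
theorem isBallClusterable_of_three_le {d n : ℕ} (x : Fin n → EuclideanSpace ℝ (Fin d))
    (hd : 3 ≤ d) (hx : ∀ i, ‖x i‖ ≤ 1) :
    IsBallClusterable ⌈Real.exp d⌉₊ (Real.exp 1 / 3) x := by
  classical
  obtain ⟨s, hsU, hsep, hmax⟩ := exists_maximal_inner_lt (d := d) (β := 0.424) (by norm_num)
    ((Finset.univ.filter fun i => x i ≠ 0).image fun i => ‖x i‖⁻¹ • x i) (by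
      intro u hu
      simp only [Finset.mem_image, Finset.mem_filter, Finset.mem_univ, true_and] at hu
      obtain ⟨i, hi, rfl⟩ := hu
      exact norm_smul_inv_norm hi)
  have hs1 : ∀ u ∈ s, ‖u‖ = 1 := by
    intro u hu
    have hu := hsU hu
    simp only [Finset.mem_image, Finset.mem_filter, Finset.mem_univ, true_and] at hu
    obtain ⟨i, hi, rfl⟩ := hu
    exact norm_smul_inv_norm hi
  have hcard : (s.card : ℝ) ≤ Real.exp d := by
    have h := card_mul_pow_le_of_inner_lt (r := √0.288) (by positivity) s hs1 (by
      rw [Real.sq_sqrt (by norm_num)]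
      norm_num
      norm_num at hsep
      exact hsep)
    rw [Real.sq_sqrt (by norm_num)] at h
    exact le_of_mul_le_mul_right (h.trans (two_mul_sqrt_pow_le hd)) (by positivity)
  have hδ : (0 : ℝ) ≤ Real.exp 1 / 3 := by positivity
  have hclose : ∀ i, x i ≠ 0 → ∃ v ∈ s, ‖x i - (0.424 : ℝ) • v‖ ≤ Real.exp 1 / 3 := by
    intro i hi
    obtain ⟨v, hv, hle⟩ := hmax (‖x i‖⁻¹ • x i) (Finset.mem_image.2 ⟨i, by simp [hi], rfl⟩)
    refine ⟨v, hv, le_of_sq_le_sq (le_trans (norm_sub_smul_sq_le (by norm_num) (by norm_num)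
      (hx i) (hs1 v hv) ?_) (le_trans (by norm_num) exp_one_div_three_sq.le)) hδ⟩
    rw [real_inner_smul_left, inv_mul_eq_div, le_div_iff₀ (norm_pos_iff.2 hi)] at hle
    exact hle
  by_cases hall : ∀ i, x i = 0
  · refine IsBallClusterable.of_finset {0} ?_ fun i => ⟨0, by simp, by simpa [hall i] using hδ⟩
    simpa using Real.exp_pos _
  push Not at hall
  obtain ⟨i₀, hi₀⟩ := hall
  obtain ⟨v₀, hv₀, -⟩ := hclose i₀ hi₀
  refine IsBallClusterable.of_finset (s.image fun v => (0.424 : ℝ) • v) ?_ fun i => ?_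
  · exact Finset.card_image_le.trans (by exact_mod_cast hcard.trans (Nat.le_ceil _))
  -- The origin has no direction; any chosen centre has norm 0.424 < e/3.
  · by_cases hi : x i = 0
    · refine ⟨_, Finset.mem_image_of_mem _ hv₀, ?_⟩
      have := Real.exp_one_gt_d9
      rw [hi, zero_sub, norm_neg, norm_smul, hs1 v₀ hv₀]
      norm_num
      linarith
    · obtain ⟨v, hv, h⟩ := hclose i hi
      exact ⟨_, Finset.mem_image_of_mem _ hv, h⟩

/-- Here p is the centre (±1/2, ±1/2) in the quadrant of x. Since x_j² ≤ |x_j|, the squared distance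
‖x‖² - |x_0| - |x_1| + 1/2 is at most 1/2. -/
theorem norm_sub_half_le {x p : EuclideanSpace ℝ (Fin 2)} (hx : ‖x‖ ≤ 1)
    (hp : ∀ j, |x j - p j| = |(|x j|) - 1 / 2|) : ‖x - p‖ ≤ Real.exp 1 / 3 := by
  have h1 : x 0 ^ 2 + x 1 ^ 2 ≤ 1 := by
    have h := pow_le_one₀ (n := 2) (norm_nonneg x) hx
    rw [EuclideanSpace.real_norm_sq_eq] at h
    simpa [Fin.sum_univ_two] using h
  refine le_of_sq_le_sq (le_trans ?_ exp_one_div_three_sq.le) (by positivity)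
  rw [EuclideanSpace.real_norm_sq_eq, Fin.sum_univ_two, ← sq_abs, ← sq_abs ((x - p) 1)]
  simp only [PiLp.sub_apply, hp]
  rw [sq_abs, sq_abs]
  have ha : ∀ j, |x j| ^ 2 = x j ^ 2 := fun j => sq_abs _
  have h0 : |x 0| ≤ 1 := by
    rw [← sq_le_one_iff_abs_le_one]; nlinarith [sq_nonneg (x 1)]
  have h2 : |x 1| ≤ 1 := by
    rw [← sq_le_one_iff_abs_le_one]; nlinarith [sq_nonneg (x 0)]
  nlinarith [ha 0, ha 1, mul_nonneg (abs_nonneg (x 0)) (sub_nonneg.2 h0),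
    mul_nonneg (abs_nonneg (x 1)) (sub_nonneg.2 h2)]

theorem isBallClusterable_two {n : ℕ} (x : Fin n → EuclideanSpace ℝ (Fin 2))
    (hx : ∀ i, ‖x i‖ ≤ 1) : IsBallClusterable ⌈Real.exp (2 : ℕ)⌉₊ (Real.exp 1 / 3) x := by
  classical
  refine IsBallClusterable.of_finset
    {!₂[1 / 2, 1 / 2], !₂[1 / 2, -1 / 2], !₂[-1 / 2, 1 / 2], !₂[-1 / 2, -1 / 2]} ?_ fun i => ?_
  · refine Finset.card_le_four.trans ?_
    have h : (4 : ℝ) ≤ Real.exp (2 : ℕ) := by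
      have := Real.exp_one_gt_d9
      rw [show ((2 : ℕ) : ℝ) = 1 + 1 by norm_num, Real.exp_add]
      nlinarith
    exact_mod_cast h.trans (Nat.le_ceil _)
  · have key : ∀ y : ℝ, (0 ≤ y → |y - 1 / 2| = |(|y|) - 1 / 2|) ∧
        (y ≤ 0 → |y - -1 / 2| = |(|y|) - 1 / 2|) := fun y =>
      ⟨fun h => by rw [abs_of_nonneg h], fun h => by
        rw [abs_of_nonpos h, ← abs_neg]; congr 1; ring⟩
    rcases le_total 0 (x i 0) with h0 | h0 <;> rcases le_total 0 (x i 1) with h1 | h1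
    · refine ⟨!₂[1 / 2, 1 / 2], by simp, norm_sub_half_le (hx i) (Fin.forall_fin_two.2 ⟨?_, ?_⟩)⟩
      exacts [(key _).1 h0, (key _).1 h1]
    · refine ⟨!₂[1 / 2, -1 / 2], by simp, norm_sub_half_le (hx i) (Fin.forall_fin_two.2 ⟨?_, ?_⟩)⟩
      exacts [(key _).1 h0, (key _).2 h1]
    · refine ⟨!₂[-1 / 2, 1 / 2], by simp, norm_sub_half_le (hx i) (Fin.forall_fin_two.2 ⟨?_, ?_⟩)⟩
      exacts [(key _).2 h0, (key _).1 h1]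
    · refine ⟨!₂[-1 / 2, -1 / 2], by simp, norm_sub_half_le (hx i) (Fin.forall_fin_two.2 ⟨?_, ?_⟩)⟩
      exacts [(key _).2 h0, (key _).2 h1]

/-- Points of the unit ball can be covered by `⌈e^d⌉` balls of radius `e / 3`. -/
theorem isBallClusterable_ceil_exp {d n : ℕ} (x : Fin n → EuclideanSpace ℝ (Fin d))
    (hd : 2 ≤ d) (hx : ∀ i, ‖x i‖ ≤ 1) :
    IsBallClusterable ⌈Real.exp d⌉₊ (Real.exp 1 / 3) x := by
  obtain rfl | hd := hd.eq_or_lt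
  · exact isBallClusterable_two x hx
  · exact isBallClusterable_of_three_le x hd hx

/-! ### The memory needed for the index problem -/

theorem PMF.toOuterMeasure_add_le_one {α : Type*} (p : PMF α) {s t : Set α} (h : Disjoint s t) :
    p.toOuterMeasure s + p.toOuterMeasure t ≤ 1 := by
  classical
  rw [PMF.toOuterMeasure_apply, PMF.toOuterMeasure_apply, ← ENNReal.tsum_add, ← p.tsum_coe]
  refine ENNReal.tsum_le_tsum fun x => ?_
  by_cases hs : x ∈ s
  · simp [hs, h.notMem_of_mem_left hs]
  · by_cases ht : x ∈ t <;> simp [hs, ht]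

theorem PMF.toOuterMeasure_le_one {α : Type*} (p : PMF α) (s : Set α) :
    p.toOuterMeasure s ≤ 1 :=
  le_self_add.trans (p.toOuterMeasure_add_le_one (disjoint_bot_right (a := s)))

/-- Convexity: on [0, 1] the function e^{2t} lies below its chord, and the two chord bounds add up.
-/
theorem Real.exp_two_mul_add_le {a b : ℝ} (ha : 0 ≤ a) (hb : 0 ≤ b) (hab : a + b ≤ 1) :
    Real.exp (2 * a) + Real.exp (2 * b) ≤ Real.exp 2 + 1 := by
  have key : ∀ t : ℝ, 0 ≤ t → t ≤ 1 → Real.exp (2 * t) ≤ 1 + t * (Real.exp 2 - 1) := by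
    intro t h0 h1
    have := convexOn_exp.2 (Set.mem_univ (0 : ℝ)) (Set.mem_univ (2 : ℝ)) (sub_nonneg.2 h1) h0
      (by ring)
    simp only [smul_eq_mul, mul_zero, zero_add, Real.exp_zero] at this
    rw [mul_comm 2 t]
    linarith
  have h1 := key a ha (by linarith)
  have h2 := key b hb (by linarith)
  have h3 : (1 : ℝ) ≤ Real.exp 2 := Real.one_le_exp (by norm_num)
  nlinarith [mul_le_mul_of_nonneg_right hab (sub_nonneg.2 h3)]

/-- This bounds the per-bit moment factor. What matters is that 1.4² = 1.96 < 2. -/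
theorem Real.exp_two_add_one_le : Real.exp 2 + 1 ≤ 1.4 * Real.exp (9 / 5) := by
  have h1 := Real.exp_one_gt_d9
  have h2 := Real.exp_one_lt_d9
  have h3 : Real.exp 2 = Real.exp 1 * Real.exp 1 := by rw [← Real.exp_add]; norm_num
  have h4 : (6 : ℝ) ≤ Real.exp (9 / 5) := by
    refine le_of_pow_le_pow_left₀ (n := 5) (by norm_num) (by positivity) ?_
    rw [← Real.exp_nat_mul, show ((5 : ℕ) : ℝ) * (9 / 5) = (9 : ℕ) * 1 by norm_num,
      Real.exp_nat_mul]
    calc (6 : ℝ) ^ 5 ≤ 2.718 ^ 9 := by norm_num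
      _ ≤ Real.exp 1 ^ 9 := by gcongr; linarith
  nlinarith

/-- If every bit vector `X` admits a state `s` whose expected number of correct predictions is at
least `9/10` of the number of bits, then there are many states. -/
theorem two_pow_card_le_of_predictors {M ι : Type*} [Fintype M] [Fintype ι]
    (g : M → ι → Bool → ℝ) (hg : ∀ s i b, 0 ≤ g s i b)
    (hg1 : ∀ s i, g s i true + g s i false ≤ 1)
    (h : ∀ X : ι → Bool, ∃ s, 9 / 10 * (Fintype.card ι : ℝ) ≤ ∑ i, g s i (X i)) :
    (2 : ℝ) ^ Fintype.card ι ≤ Fintype.card M * 1.4 ^ Fintype.card ι := by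
  classical
  set N := Fintype.card ι with hN
  -- Exponential Markov: a state that is good for X contributes at least 1. Summed over all X, the
  -- contribution of a fixed state factorizes over the bits.
  have h1 : ∀ X : ι → Bool, (1 : ℝ) ≤
      ∑ s, Real.exp (2 * (∑ i, g s i (X i)) - 9 / 5 * N) := by
    intro X
    obtain ⟨s, hs⟩ := h X
    refine le_trans ?_ (Finset.single_le_sum (fun s _ => (Real.exp_pos _).le) (Finset.mem_univ s))
    exact Real.one_le_exp (by linarith)
  have h2 : ∀ s, ∑ X : ι → Bool, Real.exp (2 * (∑ i, g s i (X i)) - 9 / 5 * N) ≤ 1.4 ^ N := by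
    intro s
    calc ∑ X : ι → Bool, Real.exp (2 * (∑ i, g s i (X i)) - 9 / 5 * N)
        = (∑ X : ι → Bool, ∏ i, Real.exp (2 * g s i (X i))) / Real.exp (9 / 5) ^ N := by
          rw [Finset.sum_div]
          refine Finset.sum_congr rfl fun X _ => ?_
          rw [Real.exp_sub, Finset.mul_sum, Real.exp_sum, ← Real.exp_nat_mul, mul_comm (N : ℝ)]
      _ = (∏ i, ∑ b, Real.exp (2 * g s i b)) / Real.exp (9 / 5) ^ N := by
          rw [Finset.prod_univ_sum, Fintype.piFinset_univ]
      _ ≤ (∏ _i : ι, (1.4 * Real.exp (9 / 5))) / Real.exp (9 / 5) ^ N := by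
          gcongr with i
          rw [Fintype.sum_bool]
          exact (Real.exp_two_mul_add_le (hg _ _ _) (hg _ _ _) (hg1 s i)).trans
            Real.exp_two_add_one_le
      _ = 1.4 ^ N := by
          rw [Finset.prod_const, Finset.card_univ, mul_pow, mul_div_assoc, div_self (by positivity),
            mul_one]
  calc (2 : ℝ) ^ N = ∑ _X : ι → Bool, (1 : ℝ) := by simp [hN]
    _ ≤ ∑ X : ι → Bool, ∑ s, Real.exp (2 * (∑ i, g s i (X i)) - 9 / 5 * N) :=
        Finset.sum_le_sum fun X _ => h1 X
    _ = ∑ s, ∑ X : ι → Bool, Real.exp (2 * (∑ i, g s i (X i)) - 9 / 5 * N) := Finset.sum_comm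
    _ ≤ ∑ _s : M, (1.4 : ℝ) ^ N := Finset.sum_le_sum fun s _ => h2 s
    _ = Fintype.card M * 1.4 ^ N := by simp

theorem PMF.sum_toReal_eq_one {α : Type*} [Fintype α] (p : PMF α) : ∑ a, (p a).toReal = 1 := by
  rw [← ENNReal.toReal_sum fun a _ => p.apply_ne_top a, ← tsum_fintype (L := .unconditional _),
    p.tsum_coe]
  simp

namespace StreamingAlgorithm

variable {S : ℕ} {I O : Type*}

theorem memoryLaw_congr (A : StreamingAlgorithm S I O) {x y : ℕ → I} :
    ∀ {t : ℕ}, (∀ i < t, x i = y i) → A.memoryLaw x t = A.memoryLaw y t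
  | 0, _ => rfl
  | t + 1, h => by
    rw [memoryLaw, memoryLaw, A.memoryLaw_congr fun i hi => h i (hi.trans t.lt_succ_self),
      h t t.lt_succ_self]

theorem outputProb_eq_sum (A : StreamingAlgorithm S I O) (x : ℕ → I) (n : ℕ) (E : Set O) :
    A.outputProb x n E = ∑ s, A.memoryLaw x (n - 1) s *
      ((A.step s (x (n - 1))).map Prod.snd).toOuterMeasure E := by
  rw [outputProb, outputLaw, PMF.toOuterMeasure_bind_apply, tsum_fintype]

/-- A streaming algorithm that can recover each bit of a bit vector with probability at least
`9/10` from its last input needs memory at least half the number of bits. -/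
theorem card_le_two_mul_of_index (A : StreamingAlgorithm S I O) {ι : Type*} [Fintype ι] (n : ℕ)
    (pre : (ι → Bool) → ℕ → I) (q : ι → I) (E : ι → Bool → Set O)
    (hE : ∀ i, Disjoint (E i true) (E i false))
    (h : ∀ X i, 9 / 10 ≤ A.outputProb (Function.update (pre X) (n - 1) (q i)) n (E i (X i))) :
    Fintype.card ι ≤ 2 * S := by
  classical
  set P : (Fin S → Bool) → ι → Bool → ℝ≥0∞ := fun s i b =>
    ((A.step s (q i)).map Prod.snd).toOuterMeasure (E i b) with hP
  have hP1 : ∀ s i b, P s i b ≤ 1 := fun s i b => PMF.toOuterMeasure_le_one _ _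
  have hPt : ∀ s i b, P s i b ≠ ⊤ := fun s i b => ((hP1 s i b).trans_lt ENNReal.one_lt_top).ne
  have key := two_pow_card_le_of_predictors (fun s i b => (P s i b).toReal)
    (fun s i b => ENNReal.toReal_nonneg) (fun s i => by
      rw [← ENNReal.toReal_add (hPt _ _ _) (hPt _ _ _)]
      exact ENNReal.toReal_le_of_le_ofReal zero_le_one (by
        simpa using PMF.toOuterMeasure_add_le_one _ (hE i))) (fun X => by
      by_contra! hcon
      -- The memory law before the last input does not depend on the query, so one μ serves every i
      -- and the guarantees can be averaged over i; some state must then reach the average.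
      set μ := A.memoryLaw (pre X) (n - 1) with hμ
      have h1 : ∀ i, (9 / 10 : ℝ) ≤ ∑ s, (μ s).toReal * (P s i (X i)).toReal := by
        intro i
        have := h X i
        rw [outputProb_eq_sum, A.memoryLaw_congr (y := pre X) fun k hk =>
          Function.update_of_ne hk.ne _ _, Function.update_self] at this
        have h2 := ENNReal.toReal_mono (by
          refine ENNReal.sum_ne_top.2 fun s _ => ENNReal.mul_ne_top (PMF.apply_ne_top _ _) ?_
          exact hPt s i (X i)) this
        rw [ENNReal.toReal_sum fun s _ =>
          ENNReal.mul_ne_top (PMF.apply_ne_top _ _) (hPt s i (X i))] at h2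
        simpa [ENNReal.toReal_mul] using h2
      have h2 : 9 / 10 * (Fintype.card ι : ℝ) ≤
          ∑ s, (μ s).toReal * ∑ i, (P s i (X i)).toReal := by
        calc 9 / 10 * (Fintype.card ι : ℝ) = ∑ _i : ι, (9 / 10 : ℝ) := by simp [mul_comm]
          _ ≤ ∑ i, ∑ s, (μ s).toReal * (P s i (X i)).toReal := Finset.sum_le_sum fun i _ => h1 i
          _ = _ := by rw [Finset.sum_comm]; simp_rw [Finset.mul_sum]
      have h3 : ∃ s, 0 < (μ s).toReal := by
        by_contra! h0
        have := μ.sum_toReal_eq_one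
        have h4 := Finset.sum_nonpos fun s (_ : s ∈ Finset.univ) => h0 s
        linarith
      obtain ⟨s₀, hs₀⟩ := h3
      have h4 : ∑ s, (μ s).toReal * ∑ i, (P s i (X i)).toReal <
          ∑ s, (μ s).toReal * (9 / 10 * (Fintype.card ι : ℝ)) :=
        Finset.sum_lt_sum (fun s _ => mul_le_mul_of_nonneg_left (hcon s).le ENNReal.toReal_nonneg)
          ⟨s₀, Finset.mem_univ _, mul_lt_mul_of_pos_left (hcon s₀) hs₀⟩
      rw [← Finset.sum_mul, μ.sum_toReal_eq_one, one_mul] at h4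
      linarith)
  set N := Fintype.card ι
  by_contra! hlt
  -- Squaring turns 1.4 into 1.96 < 2, so fewer than N bits in 2S would be contradictory.
  have h5 : (2 : ℝ) ^ N * 2 ^ N ≤ (2 ^ S * 1.4 ^ N) * (2 ^ S * 1.4 ^ N) := by
    have : ((Fintype.card (Fin S → Bool) : ℕ) : ℝ) = 2 ^ S := by simp
    rw [this] at key
    gcongr
  have h6 : (2 ^ S * 1.4 ^ N) * (2 ^ S * 1.4 ^ N) = (2 : ℝ) ^ (2 * S) * 1.96 ^ N := by
    rw [show (1.96 : ℝ) = 1.4 * 1.4 by norm_num, mul_pow, two_mul, pow_add]; ring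
  have h7 : (2 : ℝ) ^ (2 * S) * 1.96 ^ N < 2 ^ N * 2 ^ N := by
    have hN : N ≠ 0 := by omega
    have := pow_lt_pow_right₀ (one_lt_two : (1 : ℝ) < 2) hlt
    have h8 : (1.96 : ℝ) ^ N < 2 ^ N := pow_lt_pow_left₀ (by norm_num) (by norm_num) hN
    gcongr
  linarith

end StreamingAlgorithm

/-! ### Streams that encode a bit matrix -/

/-- The vector `(x, y, 0, …, 0)`. -/
noncomputable def planeVec (d : ℕ) (x y : ℝ) : EuclideanSpace ℝ (Fin d) :=
  WithLp.toLp 2 fun j => if (j : ℕ) = 0 then x else if (j : ℕ) = 1 then y else 0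

theorem planeVec_apply {d : ℕ} (x y : ℝ) (j : Fin d) :
    planeVec d x y j = if (j : ℕ) = 0 then x else if (j : ℕ) = 1 then y else 0 := rfl

theorem sum_planeVec {d : ℕ} (hd : 2 ≤ d) (x y : ℝ) : ∑ j, planeVec d x y j = x + y := by
  obtain ⟨k, rfl⟩ := Nat.exists_eq_add_of_le' hd
  simp [planeVec_apply, Fin.sum_univ_succ]

theorem planeVec_mul {d : ℕ} (x y x' y' : ℝ) (j : Fin d) :
    planeVec d x y j * planeVec d x' y' j = planeVec d (x * x') (y * y') j := by
  simp only [planeVec_apply]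
  split_ifs <;> simp

theorem norm_planeVec_sq {d : ℕ} (hd : 2 ≤ d) (x y : ℝ) :
    ‖planeVec d x y‖ ^ 2 = x ^ 2 + y ^ 2 := by
  rw [EuclideanSpace.real_norm_sq_eq, sq x, sq y, ← sum_planeVec hd]
  exact Finset.sum_congr rfl fun j _ => by rw [sq, planeVec_mul]

theorem isFixedPoint_planeVec {d b : ℕ} {x y : ℝ} (hx : IsFixedPoint b x) (hy : IsFixedPoint b y)
    (j : Fin d) : IsFixedPoint b (planeVec d x y j) := by
  rw [planeVec_apply]
  split_ifs
  exacts [hx, hy, ⟨by simp, 0, by simp⟩]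

theorem isFixedPoint_natCast_div {b k : ℕ} (h : k ≤ 4 ^ b) : IsFixedPoint b ((k : ℝ) / 2 ^ b) := by
  refine ⟨?_, k, by simp⟩
  rw [abs_of_nonneg (by positivity), div_le_iff₀ (by positivity), ← mul_pow]
  norm_num
  exact_mod_cast h

theorem isFixedPoint_intCast {b : ℕ} {z : ℤ} (h : |(z : ℝ)| ≤ 2 ^ b) : IsFixedPoint b z :=
  ⟨h, z * 2 ^ b, by push_cast; field_simp⟩

theorem tensorAttn_apply {n d : ℕ} (q : Fin d → ℝ) (K₁ K₂ V₁ V₂ : Matrix (Fin n) (Fin d) ℝ)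
    (j : Fin d) : tensorAttn q K₁ K₂ V₁ V₂ j =
      ∑ p : Fin n × Fin n, V₁ p.1 j * V₂ p.2 j * softmax ((colKron K₁ K₂).mulVec q) p := rfl

theorem colKron_mulVec_apply {n d : ℕ} (q : Fin d → ℝ) (K₁ K₂ : Matrix (Fin n) (Fin d) ℝ)
    (p : Fin n × Fin n) : (colKron K₁ K₂).mulVec q p = ∑ j, K₁ p.1 j * K₂ p.2 j * q j := rfl

/-- The sign encoding a bit. -/
def bitSign (c : Bool) : ℤ := if c then 1 else -1

theorem bitSign_mul_self (c : Bool) : (bitSign c : ℝ) * bitSign c = 1 := by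
  cases c <;> simp [bitSign]

theorem abs_bitSign (c : Bool) : |(bitSign c : ℝ)| = 1 := by
  cases c <;> simp [bitSign]

/-- The first value entry of token `t`: bit `X (t, j)` as a sign for `t < m`, and zero later. -/
def codeValue {m d : ℕ} (X : Fin m × Fin d → Bool) (t : ℕ) (j : Fin d) : ℤ :=
  if h : t < m then bitSign (X (⟨t, h⟩, j)) else 0

theorem abs_codeValue_le {m d : ℕ} (X : Fin m × Fin d → Bool) (t : ℕ) (j : Fin d) :
    |(codeValue X t j : ℝ)| ≤ 1 := by
  rw [codeValue]
  split_ifs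
  · rw [abs_bitSign]
  · simp

/-- The `t`-th token of the stream that encodes `X`: the first keys of the first `m` tokens are
points of a parabola. -/
noncomputable def codeToken (b : ℕ) {m d : ℕ} (X : Fin m × Fin d → Bool) (t : ℕ) : Token d where
  q := 0
  k₁ := if t < m then planeVec d (t / 2 ^ b) ((t ^ 2 : ℕ) / 2 ^ b) else 0
  k₂ := planeVec d ((1 : ℕ) / 2 ^ b) ((1 : ℕ) / 2 ^ b)
  v₁ := WithLp.toLp 2 fun j => codeValue X t j
  v₂ := WithLp.toLp 2 fun _ => ((1 : ℤ) : ℝ)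

/-- The token that queries the bits in row `i`. -/
noncomputable def queryToken (b n d i : ℕ) : Token d where
  q := planeVec d (4 ^ b * n * (2 * i)) (-(4 ^ b * n))
  k₁ := 0
  k₂ := planeVec d ((1 : ℕ) / 2 ^ b) ((1 : ℕ) / 2 ^ b)
  v₁ := 0
  v₂ := WithLp.toLp 2 fun _ => ((1 : ℤ) : ℝ)

/-- The stream that encodes `X` and queries row `i` with its `n`-th token. -/
noncomputable def codeStream (b n : ℕ) {m d : ℕ} (X : Fin m × Fin d → Bool) (i : ℕ) :
    ℕ → Token d :=
  Function.update (codeToken b X) (n - 1) (queryToken b n d i)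

theorem isAdmissible_codeStream {b n m d : ℕ} (hd : 2 ≤ d) (hb : 1 ≤ b)
    (hm : 2 * m ^ 2 ≤ 2 ^ b) (X : Fin m × Fin d → Bool) (i : ℕ) :
    IsAdmissible b n (codeStream b n X i) := by
  have h2 : (2 : ℝ) ≤ 2 ^ b := by
    calc (2 : ℝ) = 2 ^ 1 := by norm_num
      _ ≤ 2 ^ b := pow_le_pow_right₀ (by norm_num) hb
  have h24 : (2 : ℕ) ^ b ≤ 4 ^ b := Nat.pow_le_pow_left (by norm_num) _
  have hzero : IsFixedPoint b 0 := ⟨by simp, 0, by simp⟩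
  have hone : IsFixedPoint b ((1 : ℤ) : ℝ) := isFixedPoint_intCast (by simp; linarith)
  have hk2 : ∀ j : Fin d, IsFixedPoint b (planeVec d ((1 : ℕ) / 2 ^ b) ((1 : ℕ) / 2 ^ b) j) :=
    isFixedPoint_planeVec (isFixedPoint_natCast_div (Nat.one_le_pow _ _ (by norm_num)))
      (isFixedPoint_natCast_div (Nat.one_le_pow _ _ (by norm_num)))
  have hhalf : ∀ k : ℕ, 2 * k ≤ 2 ^ b → (k : ℝ) / 2 ^ b ≤ 1 / 2 := by
    intro k hk
    rw [div_le_div_iff₀ (by positivity) (by norm_num)]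
    have : (2 : ℝ) * k ≤ 2 ^ b := by exact_mod_cast hk
    linarith
  have hnorm : ∀ k l : ℕ, 2 * k ≤ 2 ^ b → 2 * l ≤ 2 ^ b →
      ‖planeVec d ((k : ℝ) / 2 ^ b) ((l : ℝ) / 2 ^ b)‖ ≤ 1 := by
    intro k l hk hl
    rw [← sq_le_one_iff₀ (norm_nonneg _), norm_planeVec_sq hd]
    have h1 := hhalf k hk
    have h2 := hhalf l hl
    have h3 : 0 ≤ (k : ℝ) / 2 ^ b := by positivity
    have h4 : 0 ≤ (l : ℝ) / 2 ^ b := by positivity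
    nlinarith
  have h2b : 2 * 1 ≤ 2 ^ b := by exact_mod_cast h2
  intro t _
  by_cases ht : t = n - 1
  · rw [codeStream, ht, Function.update_self]
    refine ⟨by simp [queryToken], hnorm _ _ h2b h2b, fun j => ⟨hzero, hk2 j, hzero, hone⟩⟩
  · rw [codeStream, Function.update_of_ne ht]
    refine ⟨?_, hnorm _ _ h2b h2b, fun j => ⟨?_, hk2 j, ?_, hone⟩⟩
    · simp only [codeToken]
      split_ifs with htm
      · exact hnorm _ _ (by nlinarith) (by nlinarith)
      · simp
    · simp only [codeToken]
      split_ifs with htm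
      · exact isFixedPoint_planeVec (isFixedPoint_natCast_div (by nlinarith))
          (isFixedPoint_natCast_div (by nlinarith)) j
      · exact hzero
    · exact isFixedPoint_intCast ((abs_codeValue_le X t j).trans (by linarith))

theorem V₁_codeStream {b n m d : ℕ} (hmn : m + 1 ≤ n) (X : Fin m × Fin d → Bool) (i : ℕ)
    (a : Fin n) (j : Fin d) : Token.V₁ (codeStream b n X i) n a j = codeValue X a j := by
  by_cases ha : (a : ℕ) = n - 1
  · have : ¬ n - 1 < m := by omega
    simp [Token.V₁, codeStream, ha, queryToken, codeValue, this]
  · simp [Token.V₁, codeStream, Function.update_of_ne ha, codeToken]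

theorem V₂_codeStream {b n m d : ℕ} (X : Fin m × Fin d → Bool) (i : ℕ)
    (a : Fin n) (j : Fin d) : Token.V₂ (codeStream b n X i) n a j = 1 := by
  by_cases ha : (a : ℕ) = n - 1
  · simp [Token.V₂, codeStream, ha, queryToken]
  · simp [Token.V₂, codeStream, Function.update_of_ne ha, codeToken]

theorem K₁_codeStream {b n m d : ℕ} (hmn : m + 1 ≤ n) (X : Fin m × Fin d → Bool) (i : ℕ)
    (a : Fin n) (j : Fin d) : Token.K₁ (codeStream b n X i) n a j =
      if (a : ℕ) < m then planeVec d (a / 2 ^ b) ((a ^ 2 : ℕ) / 2 ^ b) j else 0 := by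
  by_cases ha : (a : ℕ) = n - 1
  · have : ¬ n - 1 < m := by omega
    simp [Token.K₁, codeStream, ha, queryToken, this]
  · simp only [Token.K₁, codeStream, Function.update_of_ne ha, codeToken, Matrix.of_apply]
    split_ifs <;> rfl

theorem K₂_codeStream {b n m d : ℕ} (X : Fin m × Fin d → Bool) (i : ℕ)
    (a : Fin n) (j : Fin d) : Token.K₂ (codeStream b n X i) n a j =
      planeVec d ((1 : ℕ) / 2 ^ b) ((1 : ℕ) / 2 ^ b) j := by
  by_cases ha : (a : ℕ) = n - 1
  · simp [Token.K₂, codeStream, ha, queryToken]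
  · simp [Token.K₂, codeStream, Function.update_of_ne ha, codeToken]

/-- The scores of the query for row `i` peak at row `i`. -/
theorem score_codeStream {b n m d : ℕ} (hd : 2 ≤ d) (hmn : m + 1 ≤ n)
    (X : Fin m × Fin d → Bool) (i : ℕ) (p : Fin n × Fin n) (hp : (p.1 : ℕ) < m) :
    (colKron (Token.K₁ (codeStream b n X i) n) (Token.K₂ (codeStream b n X i) n)).mulVec
      (Token.query (codeStream b n X i) n) p = n * ((i : ℝ) ^ 2 - ((p.1 : ℕ) - (i : ℝ)) ^ 2) := by
  have hq : ∀ j, Token.query (codeStream b n X i) n j =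
      planeVec d (4 ^ b * n * (2 * i)) (-(4 ^ b * n)) j := fun j => by
    simp [Token.query, codeStream, queryToken]
  rw [colKron_mulVec_apply]
  simp only [K₁_codeStream hmn, K₂_codeStream, hq, if_pos hp, planeVec_mul]
  -- The factor 4^b in the query cancels the two scalings 2^{-b}; what remains is the completed
  -- square 2it - t² = i² - (t - i)², times n.
  rw [sum_planeVec hd, show (4 : ℝ) ^ b = 2 ^ b * 2 ^ b by rw [← mul_pow]; norm_num]
  field_simp
  push_cast
  ring

/-- Every competing coded row scores at least n below row i, so fewer than n of them contribute less
than n e^{-n} < 1 relative to row i, which therefore fixes the sign. -/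
theorem codeStream_attn_sign {b n m d : ℕ} (hd : 2 ≤ d) (hmn : m + 1 ≤ n)
    (X : Fin m × Fin d → Bool) (i : Fin m) (j : Fin d) :
    0 < bitSign (X (i, j)) * Token.attn (codeStream b n X i) n j := by
  set z := (colKron (Token.K₁ (codeStream b n X i) n)
    (Token.K₂ (codeStream b n X i) n)).mulVec (Token.query (codeStream b n X i) n) with hz
  set σ : ℝ := ((bitSign (X (i, j)) : ℤ) : ℝ) with hσ
  have hn : 0 < n := by omega
  have : NeZero n := ⟨hn.ne'⟩
  have hZ : 0 < ∑ p, Real.exp (z p) := Finset.sum_pos (fun p _ => Real.exp_pos _) ⟨(0, 0), by simp⟩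
  have hattn : Token.attn (codeStream b n X i) n j =
      (∑ p : Fin n × Fin n, codeValue X p.1 j * Real.exp (z p)) / ∑ p, Real.exp (z p) := by
    rw [Token.attn, tensorAttn_apply, Finset.sum_div]
    refine Finset.sum_congr rfl fun p _ => ?_
    rw [V₁_codeStream hmn, V₂_codeStream, softmax, mul_one, mul_div_assoc]
  rw [hattn, ← mul_div_assoc]
  refine div_pos ?_ hZ
  -- The second keys and values are constant along the stream, so positivity can be checked for each
  -- second index separately.
  rw [Finset.mul_sum, Fintype.sum_prod_type_right]
  refine Finset.sum_pos (fun b' _ => ?_) ⟨0, by simp⟩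
  let i' : Fin n := ⟨i, by omega⟩
  have hterm : σ * (codeValue X i' j * Real.exp (z (i', b'))) = Real.exp (n * (i : ℝ) ^ 2) := by
    have h1 : codeValue X i' j = bitSign (X (i, j)) := by simp [codeValue, i']
    rw [h1, ← mul_assoc, hσ, bitSign_mul_self, one_mul, hz, score_codeStream hd hmn X i _ i.2]
    simp [i']
  have hother : ∀ a : Fin n, a ≠ i' → -(Real.exp (n * (i : ℝ) ^ 2) * Real.exp (-n)) ≤
      σ * (codeValue X a j * Real.exp (z (a, b'))) := by
    intro a ha
    by_cases ham : (a : ℕ) < m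
    · rw [← Real.exp_add, ← mul_assoc]
      have h1 : |σ * codeValue X a j| ≤ 1 := by
        rw [abs_mul, hσ, abs_bitSign, one_mul]; exact abs_codeValue_le _ _ _
      have h2 : Real.exp (z (a, b')) ≤ Real.exp (n * (i : ℝ) ^ 2 + -n) := by
        rw [Real.exp_le_exp, hz, score_codeStream hd hmn X i _ ham]
        have h3 : (1 : ℝ) ≤ ((a : ℕ) - (i : ℕ) : ℝ) ^ 2 := by
          have : ((a : ℕ) : ℤ) - (i : ℕ) ≠ 0 := by
            intro h
            exact ha (Fin.ext (by simp only [i']; omega))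
          have := Int.one_le_abs this
          rw [← sq_abs]
          have h4 : (1 : ℝ) ≤ |((a : ℕ) - (i : ℕ) : ℝ)| := by exact_mod_cast this
          nlinarith
        have h5 : (0 : ℝ) ≤ n := n.cast_nonneg
        simp only
        nlinarith
      have h3 := (abs_le.1 h1).1
      nlinarith [Real.exp_pos (z (a, b'))]
    · have : codeValue X a j = 0 := by simp [codeValue, ham]
      rw [this]
      simp only [Int.cast_zero, zero_mul, mul_zero, Left.neg_nonpos_iff]
      positivity
  rw [← Finset.add_sum_erase _ _ (Finset.mem_univ i'), hterm]
  have hsum := Finset.card_nsmul_le_sum (Finset.univ.erase i')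
    (fun a => σ * (codeValue X a j * Real.exp (z (a, b')))) _
    fun a ha => hother a (Finset.ne_of_mem_erase ha)
  rw [Finset.card_erase_of_mem (Finset.mem_univ _), Finset.card_univ, Fintype.card_fin,
    nsmul_eq_mul] at hsum
  have hsmall : (n : ℝ) * Real.exp (-n) < 1 := by
    rw [Real.exp_neg, ← div_eq_mul_inv, div_lt_one (Real.exp_pos _)]
    linarith [Real.add_one_le_exp (n : ℝ)]
  have hsub : ((n - 1 : ℕ) : ℝ) ≤ n := by exact_mod_cast Nat.sub_le _ _
  have hpos := Real.exp_pos (n * (i : ℝ) ^ 2)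
  have h6 : ((n - 1 : ℕ) : ℝ) * Real.exp (-n) < 1 :=
    (mul_le_mul_of_nonneg_right hsub (Real.exp_pos _).le).trans_lt hsmall
  nlinarith

/-! ### The lower bound from the index problem -/

/-- An algorithm for tensor attention with a relative error guarantee solves the index problem for
`m * d` bits. -/
theorem mul_le_two_mul_of_relativeApprox {b n m d S : ℕ} {η : ℝ} (hd : 2 ≤ d) (hb : 1 ≤ b)
    (hm : 2 * m ^ 2 ≤ 2 ^ b) (hmn : m + 1 ≤ n) (hη : η < 1) (A : AttnAlgorithm S d)
    (hA : ∀ x : ℕ → Token d, IsAdmissible b n x →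
      9 / 10 ≤ A.outputProb x n (relativeApprox x n η)) :
    m * d ≤ 2 * S := by
  have h := A.card_le_two_mul_of_index (ι := Fin m × Fin d) n (fun X => codeToken b X)
    (fun i => queryToken b n d i.1) (fun i c => {o | 0 < (bitSign c : ℝ) * o i.2})
    (fun i => by
      rw [Set.disjoint_left]
      intro o h1 h2
      simp only [bitSign, Set.mem_ofPred_eq] at h1 h2
      norm_num at h1 h2
      linarith)
    (fun X i => by
      refine (hA (codeStream b n X i.1) (isAdmissible_codeStream hd hb hm X _)).trans
        (MeasureTheory.OuterMeasure.mono _ fun o ho => ?_)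
      have hs := codeStream_attn_sign (b := b) hd hmn X i.1 i.2
      have ho := ho i.2
      set y := Token.attn (codeStream b n X i.1) n i.2
      rw [Set.mem_ofPred_eq]
      -- Attention is nonzero here, so η < 1 gives a strict inequality and the sign survives.
      have hy : 0 < |y| := abs_pos.2 fun h0 => by simp [h0] at hs
      have hlt : |o i.2 - y| < |y| := ho.trans_lt (by nlinarith)
      have h3 : |(bitSign (X i) : ℝ) * (o i.2 - y)| < |(bitSign (X i) : ℝ) * y| := by
        rwa [abs_mul, abs_mul, abs_bitSign, one_mul, one_mul]
      rw [abs_of_pos hs] at h3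
      linarith [(abs_lt.1 h3).1])
  simpa using h

theorem IsLowDim.dim_isLittleO_bits {d b : ℕ → ℕ} (h : IsLowDim d b) :
    (fun n => (d n : ℝ)) =o[atTop] fun n => (b n : ℝ) :=
  h.dim.trans_isBigO h.bits.2

theorem IsLowDim.eventually_le {d b : ℕ → ℕ} (h : IsLowDim d b) :
    ∀ᶠ n : ℕ in atTop, 2 * (d n : ℝ) ≤ Real.log n ∧ 5 * (d n : ℝ) ≤ b n * Real.log 2 := by
  have h2 : 0 < Real.log 2 := Real.log_pos (by norm_num)
  filter_upwards [h.dim.def (c := 1 / 2) (by norm_num),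
    h.dim_isLittleO_bits.def (c := Real.log 2 / 5) (by positivity), eventually_ge_atTop 1] with n h3 h4 hn
  have h5 : 0 ≤ Real.log n := Real.log_nonneg (by exact_mod_cast hn)
  simp only [Real.norm_natCast, Real.norm_of_nonneg h5] at h3 h4
  constructor <;> linarith

/-- In the low-dimensional regime relative approximation needs `Ω(d e^d)` bits. -/
theorem memory_lower_bound {d b : ℕ → ℕ} (h : IsLowDim d b) :
    ∀ᶠ n : ℕ in atTop, ∀ η : ℝ, 0 < η → η < 1 → ∀ (S : ℕ) (A : AttnAlgorithm S (d n)),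
      (∀ x : ℕ → Token (d n), IsAdmissible (b n) n x →
        9 / 10 ≤ A.outputProb x n (relativeApprox x n η)) →
      1 / 2 * (d n * Real.exp (d n)) ≤ S := by
  filter_upwards [h.eventually_le, eventually_ge_atTop 1] with n ⟨hlog, hbits⟩ hn η _ hη1 S A hA
  have hd := h.two_le n
  have hd' : (2 : ℝ) ≤ d n := by exact_mod_cast hd
  have hexp : (7 : ℝ) ≤ Real.exp (d n) := by
    have h1 := Real.exp_one_gt_d9
    calc (7 : ℝ) ≤ Real.exp 1 * Real.exp 1 := by nlinarith
      _ = Real.exp 2 := by rw [← Real.exp_add]; norm_num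
      _ ≤ Real.exp (d n) := Real.exp_le_exp.2 hd'
  set e := Real.exp (d n) with he
  have hm : ((⌈e⌉₊ : ℕ) : ℝ) < e + 1 := Nat.ceil_lt_add_one (by positivity)
  have hb : 1 ≤ b n := by
    by_contra! h0
    have : b n = 0 := by omega
    rw [this] at hbits
    norm_num at hbits
    linarith
  have h1 : 2 * ⌈e⌉₊ ^ 2 ≤ 2 ^ b n := by
    have h2 : e ^ 5 ≤ 2 ^ b n := by
      rw [he, ← Real.exp_nat_mul, ← Real.rpow_natCast, Real.rpow_def_of_pos (by norm_num),
        Real.exp_le_exp]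
      push_cast
      linarith
    have h3 : 2 * ((⌈e⌉₊ : ℕ) : ℝ) ^ 2 ≤ e ^ 5 := by
      have h4 : ((⌈e⌉₊ : ℕ) : ℝ) ^ 2 ≤ (2 * e) ^ 2 := by gcongr; linarith
      have h5 : (7 : ℝ) ^ 3 * e ^ 2 ≤ e ^ 3 * e ^ 2 := by gcongr
      nlinarith [sq_nonneg e]
    exact_mod_cast h3.trans h2
  have h2 : ⌈e⌉₊ + 1 ≤ n := by
    have h3 : e ^ 2 ≤ n := by
      rw [he, ← Real.exp_nat_mul, ← Real.le_log_iff_exp_le (by exact_mod_cast hn)]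
      push_cast
      linarith
    have h4 : ((⌈e⌉₊ : ℕ) : ℝ) + 1 ≤ n := by nlinarith
    exact_mod_cast h4
  have key := mul_le_two_mul_of_relativeApprox hd hb h1 h2 hη1 A hA
  have key' : ((⌈e⌉₊ : ℕ) : ℝ) * d n ≤ 2 * S := by exact_mod_cast key
  have h6 : e * d n ≤ ((⌈e⌉₊ : ℕ) : ℝ) * d n := by gcongr; exact Nat.le_ceil e
  linarith

/-! ### Self-normalized uniform sampling -/

/-- The second moment of a sum of `T` independent uniform samples of a centred function. -/
theorem card_mul_sum_sq_sum_eq {P : Type*} [Fintype P] (f : P → ℝ) (hf : ∑ p, f p = 0) (T : ℕ) :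
    Fintype.card P * ∑ ω : Fin T → P, (∑ c, f (ω c)) ^ 2 =
      T * (Fintype.card P : ℝ) ^ T * ∑ p, f p ^ 2 := by
  induction T with
  | zero => simp
  | succ T ih =>
    have h1 : ∑ ω : Fin (T + 1) → P, (∑ c, f (ω c)) ^ 2 =
        (Fintype.card P : ℝ) ^ T * ∑ p, f p ^ 2 +
          Fintype.card P * ∑ ω : Fin T → P, (∑ c, f (ω c)) ^ 2 := by
      -- Split off the first sample; the cross term vanishes because f sums to zero.
      rw [← (Fin.consEquiv fun _ : Fin (T + 1) => P).sum_comp, Fintype.sum_prod_type]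
      simp only [Fin.consEquiv_apply, Fin.sum_univ_succ, Fin.cons_zero, Fin.cons_succ, add_sq,
        Finset.sum_add_distrib, ← Finset.mul_sum, ← Finset.sum_mul, hf]
      simp [Finset.mul_sum]
    rw [h1, mul_add, ih]
    push_cast
    ring

section Sampling

variable {P : Type*} [Fintype P] {T : ℕ}

/-- The softmax average of `v`. -/
noncomputable def softmaxMean (z v : P → ℝ) : ℝ := ∑ p, v p * softmax z p

/-- The softmax average of `v` over the sample `ω`. -/
noncomputable def sampleMean (z v : P → ℝ) (ω : Fin T → P) : ℝ :=
  (∑ c, Real.exp (z (ω c)) * v (ω c)) / ∑ c, Real.exp (z (ω c))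

/-- This centring makes the numerator of the self-normalized error have mean zero under uniform
sampling. -/
theorem sum_exp_mul_sub_softmaxMean [Nonempty P] (z v : P → ℝ) :
    ∑ p, Real.exp (z p) * (v p - softmaxMean z v) = 0 := by
  have hZ : 0 < ∑ p, Real.exp (z p) :=
    Finset.sum_pos (fun p _ => Real.exp_pos _) Finset.univ_nonempty
  have h : softmaxMean z v * ∑ p, Real.exp (z p) = ∑ p, Real.exp (z p) * v p := by
    rw [softmaxMean, Finset.sum_mul]
    refine Finset.sum_congr rfl fun p _ => ?_
    rw [softmax]
    field_simp
  simp only [mul_sub, Finset.sum_sub_distrib, ← Finset.sum_mul]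
  rw [← h]
  ring

/-- Variance is at most the second moment, for the weights e^z. -/
theorem sum_exp_mul_sub_softmaxMean_sq_le [Nonempty P] (z v : P → ℝ) :
    ∑ p, Real.exp (z p) * (v p - softmaxMean z v) ^ 2 ≤ ∑ p, Real.exp (z p) * v p ^ 2 := by
  set o := softmaxMean z v
  have h := sum_exp_mul_sub_softmaxMean z v
  have h1 : ∑ p, Real.exp (z p) * v p ^ 2 = ∑ p, Real.exp (z p) * (v p - o) ^ 2 +
      2 * o * (∑ p, Real.exp (z p) * (v p - o)) + o ^ 2 * ∑ p, Real.exp (z p) := by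
    rw [Finset.mul_sum, Finset.mul_sum, ← Finset.sum_add_distrib, ← Finset.sum_add_distrib]
    exact Finset.sum_congr rfl fun p _ => by ring
  rw [h1, h]
  have : 0 ≤ o ^ 2 * ∑ p, Real.exp (z p) :=
    mul_nonneg (sq_nonneg _) (Finset.sum_nonneg fun p _ => (Real.exp_pos _).le)
  linarith

/-- The mean squared error of self-normalized uniform sampling. -/
theorem card_mul_sum_sampleMean_sub_sq_le [Nonempty P] {z : P → ℝ} {R : ℝ} (hz : ∀ p, |z p| ≤ R)
    (v : P → ℝ) (hT : 0 < T) :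
    Fintype.card P * ∑ ω : Fin T → P, (sampleMean z v ω - softmaxMean z v) ^ 2 ≤
      Real.exp (4 * R) / T * (Fintype.card P : ℝ) ^ T * ∑ p, v p ^ 2 := by
  have hT' : (0 : ℝ) < T := by exact_mod_cast hT
  have : NeZero T := ⟨hT.ne'⟩
  set o := softmaxMean z v with ho
  set f : P → ℝ := fun p => Real.exp (z p) * (v p - o) with hf
  have hle : ∀ p, Real.exp (z p) ≤ Real.exp R := fun p => Real.exp_le_exp.2 (abs_le.1 (hz p)).2
  have hge : ∀ p, Real.exp (-R) ≤ Real.exp (z p) := fun p => Real.exp_le_exp.2 (abs_le.1 (hz p)).1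
  -- The error is exactly a centred sum over a denominator that is at least T e^{-R} for every
  -- sample, so the ratio needs no concentration argument.
  have herr : ∀ ω : Fin T → P, (sampleMean z v ω - o) ^ 2 ≤
      Real.exp (2 * R) / T ^ 2 * (∑ c, f (ω c)) ^ 2 := by
    intro ω
    have hD : T * Real.exp (-R) ≤ ∑ c, Real.exp (z (ω c)) := by
      have := Finset.card_nsmul_le_sum Finset.univ (fun c => Real.exp (z (ω c))) _
        fun c _ => hge (ω c)
      simpa using this
    have hD0 : 0 < T * Real.exp (-R) := by positivity
    have h1 : sampleMean z v ω - o = (∑ c, f (ω c)) / ∑ c, Real.exp (z (ω c)) := by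
      rw [sampleMean, eq_div_iff (hD0.trans_le hD).ne', sub_mul,
        div_mul_cancel₀ _ (hD0.trans_le hD).ne', Finset.mul_sum, ← Finset.sum_sub_distrib]
      exact Finset.sum_congr rfl fun c _ => by simp only [hf]; ring
    rw [h1, div_pow, div_mul_eq_mul_div, div_le_div_iff₀ (by positivity) (by positivity)]
    have h2 : (T : ℝ) ^ 2 ≤ Real.exp (2 * R) * (∑ c, Real.exp (z (ω c))) ^ 2 := by
      have h3 : (T * Real.exp (-R)) ^ 2 ≤ (∑ c, Real.exp (z (ω c))) ^ 2 := by gcongr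
      calc (T : ℝ) ^ 2 = Real.exp (2 * R) * (T * Real.exp (-R)) ^ 2 := by
            rw [mul_pow, ← Real.exp_nat_mul, mul_left_comm, ← Real.exp_add]
            simp
        _ ≤ _ := by gcongr
    nlinarith [mul_le_mul_of_nonneg_left h2 (sq_nonneg (∑ c, f (ω c)))]
  have hF : ∑ p, f p ^ 2 ≤ Real.exp (2 * R) * ∑ p, v p ^ 2 := by
    calc ∑ p, f p ^ 2 = ∑ p, Real.exp (z p) * (Real.exp (z p) * (v p - o) ^ 2) :=
          Finset.sum_congr rfl fun p _ => by simp only [hf]; ring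
      _ ≤ ∑ p, Real.exp R * (Real.exp (z p) * (v p - o) ^ 2) :=
          Finset.sum_le_sum fun p _ => mul_le_mul_of_nonneg_right (hle p) (by positivity)
      _ = Real.exp R * ∑ p, Real.exp (z p) * (v p - o) ^ 2 := by rw [Finset.mul_sum]
      _ ≤ Real.exp R * ∑ p, Real.exp (z p) * v p ^ 2 := by
          exact mul_le_mul_of_nonneg_left (sum_exp_mul_sub_softmaxMean_sq_le z v)
            (Real.exp_pos _).le
      _ ≤ Real.exp R * ∑ p, Real.exp R * v p ^ 2 := by
          gcongr with p
          exact (abs_le.1 (hz p)).2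
      _ = Real.exp (2 * R) * ∑ p, v p ^ 2 := by
          rw [← Finset.mul_sum, ← mul_assoc, ← Real.exp_add, two_mul]
  calc Fintype.card P * ∑ ω : Fin T → P, (sampleMean z v ω - o) ^ 2
      ≤ Fintype.card P * ∑ ω : Fin T → P, Real.exp (2 * R) / T ^ 2 * (∑ c, f (ω c)) ^ 2 := by
        gcongr with ω
        exact herr ω
    _ = Real.exp (2 * R) / T ^ 2 *
          (Fintype.card P * ∑ ω : Fin T → P, (∑ c, f (ω c)) ^ 2) := by
        rw [← Finset.mul_sum]; ring
    _ = Real.exp (2 * R) / T * (Fintype.card P : ℝ) ^ T * ∑ p, f p ^ 2 := by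
        rw [card_mul_sum_sq_sum_eq f (sum_exp_mul_sub_softmaxMean z v)]
        field_simp
    _ ≤ Real.exp (2 * R) / T * (Fintype.card P : ℝ) ^ T *
          (Real.exp (2 * R) * ∑ p, v p ^ 2) := by gcongr
    _ = Real.exp (4 * R) / T * (Fintype.card P : ℝ) ^ T * ∑ p, v p ^ 2 := by
        rw [show 4 * R = 2 * R + 2 * R by ring, Real.exp_add]; ring

end Sampling

/-! ### Norm comparisons and the Chebyshev bound -/

theorem vecNorm₂_sq {ι : Type*} [Fintype ι] (v : ι → ℝ) : vecNorm₂ v ^ 2 = ∑ i, v i ^ 2 := by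
  rw [vecNorm₂, EuclideanSpace.real_norm_sq_eq]

theorem vecNorm₂_nonneg {ι : Type*} [Fintype ι] (v : ι → ℝ) : 0 ≤ vecNorm₂ v := norm_nonneg _

theorem matNorm₂_nonneg {ι : Type*} [Fintype ι] {d : ℕ} (M : Matrix ι (Fin d) ℝ) :
    0 ≤ matNorm₂ M := norm_nonneg _

/-- The squared Frobenius norm is at most the number of columns times the squared spectral norm. -/
theorem sum_sq_le_mul_matNorm₂_sq {ι : Type*} [Fintype ι] {d : ℕ} (M : Matrix ι (Fin d) ℝ) :
    ∑ j, ∑ i, M i j ^ 2 ≤ d * matNorm₂ M ^ 2 := by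
  have h : ∀ j, ∑ i, M i j ^ 2 ≤ matNorm₂ M ^ 2 := by
    intro j
    have h1 := (LinearMap.toContinuousLinearMap (Matrix.toLpLin 2 2 M)).le_opNorm
      (EuclideanSpace.single j (1 : ℝ))
    rw [PiLp.norm_single, norm_one, mul_one] at h1
    have h2 := pow_le_pow_left₀ (norm_nonneg _) h1 2
    rw [EuclideanSpace.real_norm_sq_eq] at h2
    simpa [matNorm₂, Matrix.toLpLin_apply] using h2
  calc ∑ j, ∑ i, M i j ^ 2 ≤ ∑ _j : Fin d, matNorm₂ M ^ 2 := Finset.sum_le_sum fun j _ => h j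
    _ = d * matNorm₂ M ^ 2 := by simp

/-- The squared Euclidean norm of softmax weights is at least that of uniform weights. -/
theorem one_le_card_mul_softmax_sq {P : Type*} [Fintype P] [Nonempty P] (z : P → ℝ) :
    1 ≤ Fintype.card P * vecNorm₂ (softmax z) ^ 2 := by
  have hZ : 0 < ∑ p, Real.exp (z p) :=
    Finset.sum_pos (fun p _ => Real.exp_pos _) Finset.univ_nonempty
  have h1 : ∑ p, softmax z p = 1 := by
    simp only [softmax, ← Finset.sum_div]
    exact div_self hZ.ne'
  have h2 := sq_sum_le_card_mul_sum_sq (s := Finset.univ) (f := softmax z)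
  rwa [h1, one_pow, ← vecNorm₂_sq] at h2

/-- Among all samples of `T` pairs, at most one in a hundred gives a bad estimate. -/
theorem card_bad_samples_le {P : Type*} [Fintype P] [Nonempty P] {d T : ℕ} {z : P → ℝ} {R ε : ℝ}
    (hz : ∀ p, |z p| ≤ R) (V : Matrix P (Fin d) ℝ) (hε : 0 < ε) (hT0 : 0 < T)
    (hT : 100 * (Real.exp (4 * R) * d) ≤ T * ε ^ 2) (B : Finset (Fin T → P))
    (hB : ∀ ω ∈ B, ε * vecNorm₂ (softmax z) * matNorm₂ V <
      vecNorm₂ fun j => sampleMean z (fun p => V p j) ω - softmaxMean z fun p => V p j) :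
    100 * (B.card : ℝ) ≤ (Fintype.card P : ℝ) ^ T := by
  set N : ℝ := ((Fintype.card P : ℕ) : ℝ) with hN
  have hN0 : 0 < N := by rw [hN]; exact_mod_cast Fintype.card_pos
  set τ := ε * vecNorm₂ (softmax z) * matNorm₂ V with hτ
  have hT' : (0 : ℝ) < T := by exact_mod_cast hT0
  have hτ0 : 0 ≤ τ := mul_nonneg (mul_nonneg hε.le (vecNorm₂_nonneg _)) (matNorm₂_nonneg _)
  set err : (Fin T → P) → ℝ := fun ω =>
    vecNorm₂ fun j => sampleMean z (fun p => V p j) ω - softmaxMean z fun p => V p j with herr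
  have hsum : N * ∑ ω, err ω ^ 2 ≤
      Real.exp (4 * R) / T * N ^ T * (d * matNorm₂ V ^ 2) := by
    calc N * ∑ ω, err ω ^ 2 = ∑ j, N * ∑ ω : Fin T → P,
          (sampleMean z (fun p => V p j) ω - softmaxMean z fun p => V p j) ^ 2 := by
          simp only [herr, vecNorm₂_sq]
          rw [Finset.sum_comm, Finset.mul_sum]
      _ ≤ ∑ j, Real.exp (4 * R) / T * N ^ T * ∑ p, V p j ^ 2 :=
          Finset.sum_le_sum fun j _ => card_mul_sum_sampleMean_sub_sq_le hz _ hT0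
      _ = Real.exp (4 * R) / T * N ^ T * ∑ j, ∑ p, V p j ^ 2 := by rw [Finset.mul_sum]
      _ ≤ _ := by gcongr; exact sum_sq_le_mul_matNorm₂_sq V
  -- This trades the 1/N of uniform averaging for the ‖w‖² of the error bound.
  have hw : 1 ≤ N * vecNorm₂ (softmax z) ^ 2 := one_le_card_mul_softmax_sq z
  have hsum2 : 100 * ∑ ω, err ω ^ 2 ≤ N ^ T * τ ^ 2 := by
    have h1 : 100 * (Real.exp (4 * R) / T * N ^ T * (d * matNorm₂ V ^ 2)) ≤
        N ^ T * (ε ^ 2 * matNorm₂ V ^ 2) := by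
      have : 100 * (Real.exp (4 * R) / T * N ^ T * (d * matNorm₂ V ^ 2)) =
          (100 * (Real.exp (4 * R) * d)) * (N ^ T * matNorm₂ V ^ 2) / T := by field_simp
      rw [this, div_le_iff₀ hT']
      calc _ ≤ (T * ε ^ 2) * (N ^ T * matNorm₂ V ^ 2) := by gcongr
        _ = _ := by ring
    have h2 : N ^ T * (ε ^ 2 * matNorm₂ V ^ 2) ≤ N * (N ^ T * τ ^ 2) := by
      calc N ^ T * (ε ^ 2 * matNorm₂ V ^ 2)
          ≤ N ^ T * (ε ^ 2 * matNorm₂ V ^ 2) * (N * vecNorm₂ (softmax z) ^ 2) :=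
            le_mul_of_one_le_right (by positivity) hw
        _ = N * (N ^ T * τ ^ 2) := by rw [hτ]; ring
    refine le_of_mul_le_mul_left (a := N) ?_ hN0
    linarith
  -- Chebyshev is void for a zero threshold, but then the second moment vanishes and no sample errs.
  rcases hτ0.eq_or_lt with h0 | hpos
  · have hempty : B = ∅ := by
      by_contra hne
      obtain ⟨ω, hω⟩ := Finset.nonempty_iff_ne_empty.2 hne
      have h3 := Finset.single_le_sum (f := fun ω => err ω ^ 2) (fun ω _ => sq_nonneg _)
        (Finset.mem_univ ω)
      have h4 : 0 < err ω := hτ0.trans_lt (hB ω hω)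
      rw [← h0] at hsum2
      nlinarith [pow_pos h4 2]
    rw [hempty]
    simp only [Finset.card_empty, Nat.cast_zero, mul_zero]
    positivity
  · have h3 : B.card * τ ^ 2 ≤ ∑ ω, err ω ^ 2 := by
      calc B.card * τ ^ 2 = ∑ _ω ∈ B, τ ^ 2 := by simp
        _ ≤ ∑ ω ∈ B, err ω ^ 2 :=
          Finset.sum_le_sum fun ω hω => pow_le_pow_left₀ hτ0 (hB ω hω).le 2
        _ ≤ ∑ ω, err ω ^ 2 :=
          Finset.sum_le_sum_of_subset_of_nonneg (Finset.subset_univ _) fun _ _ _ => sq_nonneg _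
    refine le_of_mul_le_mul_right (a := τ ^ 2) ?_ (by positivity)
    linarith

/-! ### Finite-state algorithms with deterministic steps -/

/-- The state reached from `s` after the first `t` inputs. -/
def runSteps {σ I O : Type*} (step : σ → I → σ × O) (s : σ) (x : ℕ → I) : ℕ → σ
  | 0 => s
  | t + 1 => (step (runSteps step s x t) (x t)).1

/-- The streaming algorithm given by a random initial state in `σ` and deterministic steps, with
states encoded by bit strings. -/
noncomputable def StreamingAlgorithm.ofStep {σ I O : Type*} [Nonempty σ] {S : ℕ}
    (e : σ → Fin S → Bool) (init : PMF σ) (step : σ → I → σ × O) : StreamingAlgorithm S I O where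
  init := init.map e
  step m i := PMF.pure (e (step (Function.invFun e m) i).1, (step (Function.invFun e m) i).2)

theorem StreamingAlgorithm.memoryLaw_ofStep {σ I O : Type*} [Nonempty σ] {S : ℕ}
    {e : σ → Fin S → Bool} (he : Function.Injective e) (init : PMF σ) (step : σ → I → σ × O)
    (x : ℕ → I) (t : ℕ) :
    (ofStep e init step).memoryLaw x t = init.map fun s => e (runSteps step s x t) := by
  induction t with
  | zero => rfl
  | succ t ih =>
    rw [memoryLaw, ih, PMF.bind_map]
    simp only [ofStep, PMF.pure_map, Function.comp_def, Function.leftInverse_invFun he _]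
    rfl

theorem StreamingAlgorithm.outputProb_ofStep {σ I O : Type*} [Nonempty σ] {S : ℕ}
    {e : σ → Fin S → Bool} (he : Function.Injective e) (init : PMF σ) (step : σ → I → σ × O)
    (x : ℕ → I) (n : ℕ) (E : Set O) :
    (ofStep e init step).outputProb x n E = init.toOuterMeasure
      {s | (step (runSteps step s x (n - 1)) (x (n - 1))).2 ∈ E} := by
  have h : (ofStep e init step).outputLaw x n =
      init.map fun s => (step (runSteps step s x (n - 1)) (x (n - 1))).2 := by
    rw [outputLaw, memoryLaw_ofStep he, PMF.bind_map]
    simp only [ofStep, PMF.pure_map, Function.comp_def, Function.leftInverse_invFun he _]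
    rfl
  rw [outputProb, h, PMF.toOuterMeasure_map_apply]
  rfl

/-! ### Storage of fixed-point numbers -/

/-- Numerators of fixed-point numbers with `b` binary places. -/
noncomputable abbrev FixedCode (b : ℕ) := Finset.Icc (-(4 ^ b : ℤ)) (4 ^ b)

noncomputable instance (b : ℕ) : Inhabited (FixedCode b) := ⟨⟨0, by simp⟩⟩

theorem card_fixedCode_le (b : ℕ) : Fintype.card (FixedCode b) ≤ 2 ^ (2 * b + 2) := by
  rw [Fintype.card_coe, Int.card_Icc, show (2 : ℕ) ^ (2 * b + 2) = 4 * 4 ^ b by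
    rw [pow_add, pow_mul]; norm_num; ring, Int.toNat_le]
  push_cast
  have : (1 : ℤ) ≤ 4 ^ b := one_le_pow₀ (by norm_num)
  linarith

/-- The number with the given numerator. -/
noncomputable def FixedCode.decode {b : ℕ} (z : FixedCode b) : ℝ := (z : ℤ) / 2 ^ b

open Classical in
/-- The numerator of a fixed-point number. -/
noncomputable def FixedCode.encode (b : ℕ) (y : ℝ) : FixedCode b :=
  if h : ∃ z : FixedCode b, FixedCode.decode z = y then h.choose else default

theorem FixedCode.decode_encode {b : ℕ} {y : ℝ} (hy : IsFixedPoint b y) :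
    decode (encode b y) = y := by
  have h : ∃ z : FixedCode b, FixedCode.decode z = y := by
    obtain ⟨hle, z, rfl⟩ := hy
    have h1 : |(z : ℝ)| ≤ 4 ^ b := by
      rw [abs_div, abs_of_pos (by positivity : (0 : ℝ) < 2 ^ b), div_le_iff₀ (by positivity),
        ← mul_pow] at hle
      norm_num at hle
      exact hle
    have h2 : |z| ≤ 4 ^ b := by exact_mod_cast h1
    exact ⟨⟨z, Finset.mem_Icc.2 (abs_le.1 h2)⟩, rfl⟩
  rw [encode, dif_pos h]
  exact h.choose_spec

/-! ### The sampling algorithm -/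

/-- A memory cell: the position of a token, and storage for its key and its value. -/
abbrev SampleCell (n d b : ℕ) := Fin n × (Fin d → FixedCode b) × (Fin d → FixedCode b)

/-- The memory of the sampling algorithm: a counter and `T` pairs of cells. -/
abbrev SampleState (n d b T : ℕ) := ZMod n × (Fin T → SampleCell n d b × SampleCell n d b)

theorem card_sampleState_le {n d b T a : ℕ} [NeZero n] (ha : n ≤ 2 ^ a) :
    Fintype.card (SampleState n d b T) ≤
      Fintype.card (Fin (a + 2 * T * (a + 2 * (d * (2 * b + 2)))) → Bool) := by
  have h1 : Fintype.card (Fin d → FixedCode b) ≤ 2 ^ (d * (2 * b + 2)) := by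
    rw [Fintype.card_fun, Fintype.card_fin, mul_comm d, pow_mul]
    exact Nat.pow_le_pow_left (card_fixedCode_le b) d
  have h2 : Fintype.card (SampleCell n d b) ≤ 2 ^ (a + 2 * (d * (2 * b + 2))) := by
    rw [Fintype.card_prod, Fintype.card_prod, Fintype.card_fin, pow_add, two_mul, pow_add]
    gcongr
  rw [Fintype.card_prod, ZMod.card, Fintype.card_fun, Fintype.card_prod, Fintype.card_fin,
    Fintype.card_fun, Fintype.card_bool, Fintype.card_fin]
  calc n * (Fintype.card (SampleCell n d b) * Fintype.card (SampleCell n d b)) ^ T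
      ≤ 2 ^ a * (2 ^ (a + 2 * (d * (2 * b + 2))) * 2 ^ (a + 2 * (d * (2 * b + 2)))) ^ T := by
        gcongr
    _ = 2 ^ (a + 2 * T * (a + 2 * (d * (2 * b + 2)))) := by
        rw [← pow_add, ← pow_mul, ← pow_add]
        congr 1
        ring

namespace Sampling

variable {n d b T : ℕ}

/-- Store the key and the value of the token at position `t` if the cell is meant for it. -/
noncomputable def cellStep (t : ZMod n) (k v : EuclideanSpace ℝ (Fin d))
    (c : SampleCell n d b) : SampleCell n d b :=
  if ((c.1 : ℕ) : ZMod n) = t then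
    (c.1, fun j => FixedCode.encode b (k j), fun j => FixedCode.encode b (v j)) else c

/-- The score of the pair of keys in a pair of cells. -/
noncomputable def cellScore (q : EuclideanSpace ℝ (Fin d))
    (c : SampleCell n d b × SampleCell n d b) : ℝ :=
  ∑ j, FixedCode.decode (c.1.2.1 j) * FixedCode.decode (c.2.2.1 j) * q j

/-- One step of the algorithm: update all cells, and output the self-normalized estimate. -/
noncomputable def step (s : SampleState n d b T) (x : Token d) :
    SampleState n d b T × (Fin d → ℝ) :=
  let cells : Fin T → SampleCell n d b × SampleCell n d b := fun i =>
    (cellStep s.1 x.k₁ x.v₁ (s.2 i).1, cellStep s.1 x.k₂ x.v₂ (s.2 i).2)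
  ((s.1 + 1, cells), fun j =>
    (∑ i, Real.exp (cellScore x.q (cells i)) *
      (FixedCode.decode ((cells i).1.2.2 j) * FixedCode.decode ((cells i).2.2.2 j))) /
        ∑ i, Real.exp (cellScore x.q (cells i)))

/-- The content at time `t` of the cell for position `a`. -/
noncomputable def cellAt (b : ℕ) (k v : ℕ → EuclideanSpace ℝ (Fin d)) (t : ℕ) (a : Fin n) :
    SampleCell n d b :=
  if (a : ℕ) < t then
    (a, fun j => FixedCode.encode b (k a j), fun j => FixedCode.encode b (v a j))
  else (a, default, default)

/-- Since t < n, the counter modulo n identifies the position without ambiguity, so a cell is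
written exactly when its token arrives. -/
theorem cellStep_cellAt (k v : ℕ → EuclideanSpace ℝ (Fin d)) {t : ℕ} (ht : t < n) (a : Fin n) :
    cellStep (t : ZMod n) (k t) (v t) (cellAt b k v t a) = cellAt b k v (t + 1) a := by
  have h0 : (cellAt b k v t a).1 = a := by rw [cellAt]; split_ifs <;> rfl
  simp only [cellStep, h0, ZMod.natCast_eq_natCast_iff', Nat.mod_eq_of_lt a.2,
    Nat.mod_eq_of_lt ht]
  by_cases h : (a : ℕ) = t
  · simp [cellAt, h]
  · have : (a : ℕ) < t + 1 ↔ (a : ℕ) < t := by omega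
    simp only [h, cellAt, this, if_false]

/-- The state at time `t` for the sampled positions `ω`. -/
noncomputable def stateAt (b : ℕ) (x : ℕ → Token d) (t : ℕ) (ω : Fin T → Fin n × Fin n) :
    SampleState n d b T :=
  (t, fun i => (cellAt b (fun s => (x s).k₁) (fun s => (x s).v₁) t (ω i).1,
    cellAt b (fun s => (x s).k₂) (fun s => (x s).v₂) t (ω i).2))

/-- The initial state for the sampled positions `ω`. -/
noncomputable def initState (b d : ℕ) (ω : Fin T → Fin n × Fin n) : SampleState n d b T :=
  (0, fun i => (((ω i).1, default, default), ((ω i).2, default, default)))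

theorem step_stateAt (x : ℕ → Token d) {t : ℕ} (ht : t < n) (ω : Fin T → Fin n × Fin n) :
    (step (stateAt b x t ω) (x t)).1 = stateAt b x (t + 1) ω := by
  simp only [step, stateAt, Nat.cast_succ]
  congr 1
  funext i
  rw [cellStep_cellAt (fun s => (x s).k₁) (fun s => (x s).v₁) ht,
    cellStep_cellAt (fun s => (x s).k₂) (fun s => (x s).v₂) ht]

theorem runSteps_step (x : ℕ → Token d) (ω : Fin T → Fin n × Fin n) :
    ∀ {t : ℕ}, t ≤ n → runSteps step (initState b d ω) x t = stateAt b x t ω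
  | 0, _ => by simp [runSteps, initState, stateAt, cellAt]
  | t + 1, h => by
    rw [runSteps, runSteps_step x ω (Nat.le_of_succ_le h), step_stateAt x h]

/-- Fixed-point entries are stored without loss, and cells are updated before the output is formed,
so the n-th token itself is included. -/
theorem output_eq_sampleMean (hn : 0 < n) {x : ℕ → Token d} (hx : IsAdmissible b n x)
    (ω : Fin T → Fin n × Fin n) (j : Fin d) :
    (step (stateAt b x (n - 1) ω) (x (n - 1))).2 j =
      sampleMean ((colKron (Token.K₁ x n) (Token.K₂ x n)).mulVec (Token.query x n))
        (fun p => colKron (Token.V₁ x n) (Token.V₂ x n) p j) ω := by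
  have hlt : n - 1 < n := by omega
  have hsucc : n - 1 + 1 = n := by omega
  have hcell : ∀ (k v : ℕ → EuclideanSpace ℝ (Fin d)) (a : Fin n),
      cellStep ((n - 1 : ℕ) : ZMod n) (k (n - 1)) (v (n - 1)) (cellAt b k v (n - 1) a) =
        (a, fun j => FixedCode.encode b (k a j), fun j => FixedCode.encode b (v a j)) := by
    intro k v a
    rw [cellStep_cellAt k v hlt, hsucc, cellAt, if_pos a.2]
  have h1 := fun i : Fin T => hcell (fun s => (x s).k₁) (fun s => (x s).v₁) (ω i).1
  have h2 := fun i : Fin T => hcell (fun s => (x s).k₂) (fun s => (x s).v₂) (ω i).2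
  simp only at h1 h2
  have hk1 := fun (a : Fin n) j => FixedCode.decode_encode ((hx a a.2).2.2 j).1
  have hk2 := fun (a : Fin n) j => FixedCode.decode_encode ((hx a a.2).2.2 j).2.1
  have hv1 := fun (a : Fin n) j => FixedCode.decode_encode ((hx a a.2).2.2 j).2.2.1
  have hv2 := fun (a : Fin n) j => FixedCode.decode_encode ((hx a a.2).2.2 j).2.2.2
  simp only [step, stateAt, h1, h2, cellScore, hk1, hk2, hv1, hv2]
  rfl

end Sampling

/-! ### Guarantee and cost of the sampler -/

/-- Coordinates of the first key are at most 1 in absolute value; Cauchy–Schwarz handles the second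
key and the query. -/
theorem abs_score_le {n d b : ℕ} {r : ℝ} {x : ℕ → Token d} (hn : 0 < n) (hx : IsAdmissible b n x)
    (hq : ∀ i < n, ‖(x i).q‖ ≤ r) (p : Fin n × Fin n) :
    |(colKron (Token.K₁ x n) (Token.K₂ x n)).mulVec (Token.query x n) p| ≤ r := by
  rw [colKron_mulVec_apply]
  simp only [Token.K₁, Token.K₂, Token.query, Matrix.of_apply]
  have h1 : ∀ j, |(x p.1).k₁ j| ≤ 1 := fun j =>
    (PiLp.norm_apply_le (x p.1).k₁ j).trans (hx p.1 p.1.2).1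
  have h2 := (hx p.2 p.2.2).2.1
  have h3 := hq (n - 1) (by omega)
  have hcs := Real.sum_mul_le_sqrt_mul_sqrt Finset.univ (fun j => |(x p.2).k₂ j|)
    (fun j => |(x (n - 1)).q j|)
  simp only [sq_abs] at hcs
  calc |∑ j, (x p.1).k₁ j * (x p.2).k₂ j * (x (n - 1)).q j|
      ≤ ∑ j, |(x p.1).k₁ j * (x p.2).k₂ j * (x (n - 1)).q j| := Finset.abs_sum_le_sum_abs _ _
    _ ≤ ∑ j, |(x p.2).k₂ j| * |(x (n - 1)).q j| := by
        refine Finset.sum_le_sum fun j _ => ?_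
        rw [abs_mul, abs_mul]
        gcongr
        exact mul_le_of_le_one_left (abs_nonneg _) (h1 j)
    _ ≤ ‖(x p.2).k₂‖ * ‖(x (n - 1)).q‖ := by
        simpa [EuclideanSpace.norm_eq] using hcs
    _ ≤ 1 * ‖(x (n - 1)).q‖ := by gcongr
    _ ≤ r := by rwa [one_mul]

theorem exists_sampling_algorithm {n d b T a : ℕ} {r ε : ℝ} (hn : 0 < n) (ha : n ≤ 2 ^ a)
    (hε : 0 < ε) (hT0 : 0 < T) (hT : 100 * (Real.exp (4 * r) * d) ≤ T * ε ^ 2) :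
    ∃ A : AttnAlgorithm (a + 2 * T * (a + 2 * (d * (2 * b + 2)))) d, ∀ x : ℕ → Token d,
      IsAdmissible b n x → (∀ i < n, ‖(x i).q‖ ≤ r) →
        99 / 100 ≤ A.outputProb x n (additiveApprox x n ε) := by
  classical
  have : NeZero n := ⟨hn.ne'⟩
  obtain ⟨e⟩ := Function.Embedding.nonempty_of_card_le (card_sampleState_le (d := d) (b := b)
    (T := T) ha)
  refine ⟨StreamingAlgorithm.ofStep e
    ((PMF.uniformOfFintype (Fin T → Fin n × Fin n)).map (Sampling.initState b d)) Sampling.step,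
    fun x hx hq => ?_⟩
  rw [StreamingAlgorithm.outputProb_ofStep e.injective, PMF.toOuterMeasure_map_apply]
  set z := (colKron (Token.K₁ x n) (Token.K₂ x n)).mulVec (Token.query x n) with hz
  set V := colKron (Token.V₁ x n) (Token.V₂ x n) with hV
  set G : Finset (Fin T → Fin n × Fin n) := Finset.univ.filter fun ω =>
    (vecNorm₂ fun j => sampleMean z (fun p => V p j) ω - softmaxMean z fun p => V p j) ≤
      ε * vecNorm₂ (softmax z) * matNorm₂ V with hG
  have hpre : Sampling.initState b d ⁻¹' {s | (Sampling.step
      (runSteps Sampling.step s x (n - 1)) (x (n - 1))).2 ∈ additiveApprox x n ε} =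
      (G : Set (Fin T → Fin n × Fin n)) := by
    ext ω
    rw [Set.mem_preimage, Set.mem_ofPred_eq, Sampling.runSteps_step x ω (Nat.sub_le _ _), hG,
      Finset.coe_filter]
    simp only [Finset.mem_univ, true_and, Set.mem_ofPred_eq, additiveApprox]
    have : (Sampling.step (Sampling.stateAt b x (n - 1) ω) (x (n - 1))).2 - Token.attn x n =
        fun j => sampleMean z (fun p => V p j) ω - softmaxMean z fun p => V p j := by
      funext j
      rw [Pi.sub_apply, Sampling.output_eq_sampleMean hn hx]
      rfl
    rw [this]
    rfl
  rw [hpre, PMF.toOuterMeasure_apply_finset]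
  simp only [PMF.uniformOfFintype_apply, Finset.sum_const, nsmul_eq_mul]
  have hbad := card_bad_samples_le (abs_score_le hn hx hq) V hε hT0 hT Gᶜ fun ω hω => by
    simpa [hG] using hω
  have hcompl := Finset.card_add_card_compl G
  have hcard : (Fintype.card (Fin T → Fin n × Fin n) : ℝ) =
      (Fintype.card (Fin n × Fin n) : ℝ) ^ T := by simp
  rw [← hcard, ← hcompl] at hbad
  push_cast at hbad
  have hpos : (0 : ℝ≥0∞) < Fintype.card (Fin T → Fin n × Fin n) := by
    exact_mod_cast Fintype.card_pos
  rw [← div_eq_mul_inv, ENNReal.le_div_iff_mul_le (Or.inl hpos.ne'),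
    ← ENNReal.mul_div_right_comm]
  · refine ENNReal.div_le_of_le_mul ?_
    have h99 : (99 : ℝ) * (Fintype.card (Fin T → Fin n × Fin n) : ℕ) ≤ G.card * 100 := by
      rw [← hcompl]
      push_cast
      linarith
    exact_mod_cast h99
  · exact Or.inl (ENNReal.natCast_ne_top _)

/-- In the low-dimensional regime uniform sampling of pairs of tokens uses `Õ(d e^d)` bits. -/
theorem memory_upper_bound {d b : ℕ → ℕ} {r : ℕ → ℝ} (h : IsLowDim d b)
    (hr : r =O[atTop] fun n : ℕ => Real.log (Real.log n)) :
    ∃ (C : ℝ) (K : ℕ), ∀ᶠ n : ℕ in atTop, ∀ ε : ℝ, 0 < ε → ε < 1 →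
      ∃ S : ℕ, (S : ℝ) ≤ C * ε⁻¹ ^ 2 * (d n * Real.exp (d n)) * Real.log n ^ K ∧
        ∃ A : AttnAlgorithm S (d n), ∀ x : ℕ → Token (d n),
          IsAdmissible (b n) n x → (∀ i < n, ‖(x i).q‖ ≤ r n) →
            99 / 100 ≤ A.outputProb x n (additiveApprox x n ε) := by
  obtain ⟨c₀, hc₀⟩ := hr.bound
  obtain ⟨B₀, hB₀⟩ := h.bits.1.bound
  obtain ⟨c, hc⟩ := exists_nat_ge c₀
  obtain ⟨B, hB⟩ := exists_nat_ge B₀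
  have hlog : Tendsto (fun n : ℕ => Real.log n) atTop atTop :=
    Real.tendsto_log_atTop.comp tendsto_natCast_atTop_atTop
  refine ⟨202 * (15 + 8 * B), 4 * c + 3, ?_⟩
  filter_upwards [hc₀, hB₀, h.eventually_le, hlog.eventually_ge_atTop 1, eventually_ge_atTop 1]
    with n hr hb ⟨hd, _⟩ hℓ hn ε hε hε1
  set ℓ := Real.log n with hℓdef
  have hℓ0 : 0 < ℓ := by linarith
  have hd2 : (2 : ℝ) ≤ d n := by exact_mod_cast h.two_le n
  have hb' : (b n : ℝ) ≤ B * ℓ := by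
    simp only [Real.norm_natCast, Real.norm_of_nonneg hℓ0.le] at hb
    exact hb.trans (by gcongr)
  -- The growth condition on r enters here: the sampling overhead becomes a power of log n.
  have hr' : Real.exp (4 * r n) ≤ ℓ ^ (4 * c) := by
    have h1 : 0 ≤ Real.log ℓ := Real.log_nonneg hℓ
    rw [Real.norm_of_nonneg h1] at hr
    have h2 : r n ≤ c * Real.log ℓ := (le_abs_self _).trans (hr.trans (by gcongr))
    calc Real.exp (4 * r n) ≤ Real.exp ((4 * c : ℕ) * Real.log ℓ) := by
          rw [Real.exp_le_exp]; push_cast; linarith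
      _ = ℓ ^ (4 * c) := by rw [Real.exp_nat_mul, Real.exp_log hℓ0]
  -- A position needs log n / log 2 bits, and 1/log 2 < 2.
  set a := ⌈2 * ℓ⌉₊ with hadef
  have ha : n ≤ 2 ^ a := by
    have h1 : (n : ℝ) ≤ 2 ^ a := by
      rw [← Real.rpow_natCast, Real.rpow_def_of_pos (by norm_num),
        ← Real.log_le_iff_le_exp (by exact_mod_cast hn)]
      have h2 := Real.log_two_gt_d9
      have h3 : 2 * ℓ ≤ a := Nat.le_ceil _
      nlinarith
    exact_mod_cast h1
  have ha' : (a : ℝ) ≤ 3 * ℓ := by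
    have := Nat.ceil_lt_add_one (a := 2 * ℓ) (by positivity)
    linarith
  set T := ⌈100 * (Real.exp (4 * r n) * d n) * ε⁻¹ ^ 2⌉₊ with hTdef
  have hT0 : 0 < T := Nat.ceil_pos.2 (by positivity)
  have hT : 100 * (Real.exp (4 * r n) * d n) ≤ T * ε ^ 2 := by
    have h1 : 100 * (Real.exp (4 * r n) * d n) * ε⁻¹ ^ 2 ≤ T := Nat.le_ceil _
    rwa [inv_pow, ← div_eq_mul_inv, div_le_iff₀ (by positivity)] at h1
  have hε2 : 1 ≤ ε⁻¹ ^ 2 := one_le_pow₀ ((one_le_inv₀ hε).2 hε1.le)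
  have hℓp : 1 ≤ ℓ ^ (4 * c) := one_le_pow₀ hℓ
  have hT' : (T : ℝ) ≤ 101 * ℓ ^ (4 * c) * d n * ε⁻¹ ^ 2 := by
    have h1 := Nat.ceil_lt_add_one (a := 100 * (Real.exp (4 * r n) * d n) * ε⁻¹ ^ 2)
      (by positivity)
    have h2 : 1 ≤ ℓ ^ (4 * c) * d n * ε⁻¹ ^ 2 :=
      one_le_mul_of_one_le_of_one_le (one_le_mul_of_one_le_of_one_le hℓp (by linarith)) hε2
    have h3 : 100 * (Real.exp (4 * r n) * d n) * ε⁻¹ ^ 2 ≤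
        100 * (ℓ ^ (4 * c) * d n) * ε⁻¹ ^ 2 := by gcongr
    linarith
  obtain ⟨A, hA⟩ := exists_sampling_algorithm (d := d n) (b := b n) hn ha hε hT0 hT
  refine ⟨_, ?_, A, hA⟩
  have hT1 : (1 : ℝ) ≤ T := by exact_mod_cast hT0
  have hcell : (a : ℝ) + 2 * (d n * (2 * b n + 2)) ≤ (7 + 4 * B) * ℓ ^ 2 := by
    have h1 : (d n : ℝ) * (2 * b n + 2) ≤ ℓ * (2 * (B * ℓ) + 2 * ℓ) := by
      gcongr <;> linarith
    nlinarith
  have hS : ((a + 2 * T * (a + 2 * (d n * (2 * b n + 2))) : ℕ) : ℝ) ≤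
      T * (2 * (15 + 8 * B) * ℓ ^ 2) := by
    push_cast
    have h1 : (a : ℝ) ≤ T * (3 * ℓ ^ 2) := by nlinarith
    have h2 : 2 * (T : ℝ) * (a + 2 * (d n * (2 * b n + 2))) ≤
        2 * T * ((7 + 4 * B) * ℓ ^ 2) := by gcongr
    have h3 : (0 : ℝ) ≤ T * B * ℓ ^ 2 := by positivity
    nlinarith
  calc ((a + 2 * T * (a + 2 * (d n * (2 * b n + 2))) : ℕ) : ℝ)
      ≤ T * (2 * (15 + 8 * B) * ℓ ^ 2) := hS
    _ ≤ (101 * ℓ ^ (4 * c) * d n * ε⁻¹ ^ 2) * (2 * (15 + 8 * B) * ℓ ^ 2) := by gcongr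
    _ = 202 * (15 + 8 * B) * ε⁻¹ ^ 2 * (d n * 1) * (ℓ ^ (4 * c + 2)) := by ring
    -- Pure slack: the sampler needs neither the factor e^d nor the last power of log n.
    _ ≤ 202 * (15 + 8 * B) * ε⁻¹ ^ 2 * (d n * Real.exp (d n)) * (ℓ ^ (4 * c + 3)) := by
        gcongr
        · exact Real.one_le_exp (by positivity)
        norm_num

theorem theorem6p3 :
    -- Upper bound: `Õ(d e^d)` bits suffice, with `ε⁻²` explicit and `Õ` hiding powers of `log n`.
    (∀ (d b : ℕ → ℕ) (r : ℕ → ℝ), IsLowDim d b →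
      (r =O[atTop] fun n : ℕ => Real.log (Real.log n)) →
      ∃ (C : ℝ) (K : ℕ), ∀ᶠ n : ℕ in atTop, ∀ ε : ℝ, 0 < ε → ε < 1 →
        ∃ S : ℕ, (S : ℝ) ≤ C * ε⁻¹ ^ 2 * (d n * Real.exp (d n)) * Real.log n ^ K ∧
          ∃ A : AttnAlgorithm S (d n), ∀ x : ℕ → Token (d n),
            IsAdmissible (b n) n x → (∀ i < n, ‖(x i).q‖ ≤ r n) →
              99 / 100 ≤ A.outputProb x n (additiveApprox x n ε)) ∧
    -- Clusterability of points of norm at most one.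
    (∀ (d n : ℕ) (x : Fin n → EuclideanSpace ℝ (Fin d)), 2 ≤ d → (∀ i, ‖x i‖ ≤ 1) →
      IsBallClusterable ⌈Real.exp d⌉₊ (Real.exp 1 / 3) x) ∧
    -- Lower bound: `Ω(d e^d)` bits are necessary for a `(1 ± η)`-approximation.
    (∃ c : ℝ, 0 < c ∧ ∀ d b : ℕ → ℕ, IsLowDim d b →
      ∀ᶠ n : ℕ in atTop, ∀ η : ℝ, 0 < η → η < 1 →
        ∀ (S : ℕ) (A : AttnAlgorithm S (d n)),
          (∀ x : ℕ → Token (d n), IsAdmissible (b n) n x →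
            9 / 10 ≤ A.outputProb x n (relativeApprox x n η)) →
          c * (d n * Real.exp (d n)) ≤ S) := by
  exact ⟨fun d b r h hr => memory_upper_bound h hr,
    fun d n x hd hx => isBallClusterable_ceil_exp x hd hx,
    1 / 2, by norm_num, fun d b h => memory_lower_bound h⟩
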